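/- **Setting.** Let $D$ be a distribution over triples $(X,A,Y)\in\mathcal X\times\mathcal A\times\{0,1\}$ and let $\mathcal H$ be a family of classifiers $h:\mathcal X\to\{0,1\}$. (The $h\in\mathcal H$ are measurable and, as usual for uncountable $\mathcal H$, the suprema over $h\in\mathcal H$ of the absolute values of finite sums $\sum_i a_i f(Z_i,h(X_i))+b\,\mathbb E_D f(Z,h(X))$, with $Z=(X,A,Y)$, are assumed to be measurable functions of the sample.) A randomized classifier is a probability mass function $Q\in\Delta$ on $\mathcal H$. Let $\mathrm{err}(h)=\mathbb P[h(X)\ne Y]$ and, for $j$ in a finite set $\mathcal J$, $\mu_j(h)=\mathbb E[g_j(X,A,Y,h(X))\mid\mathcal E_j]$, where $g_j$ takes values in $[0,1]$ and $\mathcal E_j$ is an event defined in terms of $(X,A,Y)$ only. For a finite set $\mathcal K$, a matrix $M\in\mathbb R^{\mathcal K\times\mathcal J}$ and $c\in\mathbb R^{\mathcal K}$, put $\mathrm{err}(Q)=\sum_h Q(h)\,\mathrm{err}(h)$, $\mu_j(Q)=\sum_h Q(h)\mu_j(h)$, $\gamma_k(Q)=\sum_j M_{kj}\mu_j(Q)$.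 Let $Q^\star$ minimize $\mathrm{err}(Q)$ over $Q\in\Delta$ subject to $\gamma_k(Q)\le c_k$ for all $k$. Given an i.i.d. sample of size $n\ge1$ from $D$, let $\widehat{\mathrm{err}}$, $\widehat\mu_j$, $\widehat\gamma_k$ be the empirical versions of these quantities, $n_j$ the number of sample points in $\mathcal E_j$ (the quantity $\widehat\mu_j$ is defined when $n_j\ge1$), and $p^\star_j=\mathbb P[\mathcal E_j]$. Let $\widehat c_k=c_k+\varepsilon_k$, let $B>0$, and $$L(Q,\lambda)=\widehat{\mathrm{err}}(Q)+\sum_k\lambda_k\bigl(\widehat\gamma_k(Q)-\widehat c_k\bigr),\qquad \Lambda=\{\lambda\in\mathbb R_{\ge0}^{\mathcal K}:\|\lambda\|_1\le B\}.$$ A pair $(\widehat Q,\widehat\lambda)\in\Delta\times\Lambda$ is a $\nu$-approximate saddle point of $L$ if $L(\widehat Q,\widehat\lambda)\le L(Q,\widehat\lambda)+\nu$ for all $Q\in\Delta$ and $L(\widehat Q,\widehat\lambda)\ge L(\widehat Q,\lambda)-\nu$ for all $\lambda\in\Lambda$. Finally let $$R_m(\mathcal H)=\sup_{x_1,\dots,x_m\in\mathcal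 X}\mathbb E_\sigma\Bigl[\sup_{h\in\mathcal H}\Bigl|\tfrac1m\sum_{i=1}^m\sigma_ih(x_i)\Bigr|\Bigr],$$ where $\sigma_1,\dots,\sigma_m$ are i.i.d. uniform on $\{-1,1\}$. **Theorem.** Let $\delta>0$, $C\ge0$, $\alpha\le 1/2$. Assume $R_m(\mathcal H)\le C m^{-\alpha}$ for all $m\ge1$ and $\varepsilon_k=C'\sum_{j}|M_{kj}|\,n_j^{-\alpha}$ for all $k$, where $C'\ge 2C+2+\sqrt{\ln(4/\delta)/2}$. Then, with probability at least $1-(|\mathcal J|+1)\delta$, the following holds simultaneously for all $\nu$-approximate saddle points $(\widehat Q,\widehat\lambda)$ of $L$. 1. If $n_j\ge1$ for all $j$ (so that $L$ is defined), then $$\mathrm{err}(\widehat Q)\le \mathrm{err}(Q^\star)+2\nu+\Bigl(4C+4+\sqrt{2\ln(4/\delta)}\Bigr)n^{-\alpha},$$ $$\gamma_k(\widehat Q)\le c_k+\frac{1+2\nu}{B}+\sum_{j}|M_{kj}|\,2C'\,n_j^{-\alpha}\quad\text{for all }k.$$ 2. If $n p^\star_j\ge 8\ln(2/\delta)$ for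 all $j$, then $n_j\ge1$ for all $j$ (so that part 1 applies), and $$\gamma_k(\widehat Q)\le c_k+\frac{1+2\nu}{B}+\sum_{j}|M_{kj}|\,4C'\,(np^\star_j)^{-\alpha}\quad\text{for all }k.$$ (Thus, for fixed $C$ and $C'$ of the order of its lower bound, the error terms are $\widetilde O(n^{-\alpha})$, $\widetilde O(n_j^{-\alpha})$ and $\widetilde O((np^\star_j)^{-\alpha})$, where $\widetilde O$ hides polynomial dependence on $\ln(1/\delta)$. Where $\delta\geq 1$, the probability bound is trivial.) -/

import Mathlib

open MeasureTheory ProbabilityTheory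

noncomputable section

namespace FairClass

/-- A data point `(x, a, y)`: features, protected attribute, label in `{0, 1}`. -/
abbrev Point (𝒳 𝒜 : Type*) := 𝒳 × 𝒜 × Fin 2

/-- The (worst-case) Rademacher complexity of a family of classifiers `𝒳 → {0, 1}`:
`sup_{x₁,…,xₙ} E_σ sup_{h ∈ H} |(1/n) ∑ᵢ σᵢ h(xᵢ)|`, where `σ` is uniform on `{-1, 1}ⁿ`. -/
def rademacher {𝒳 : Type*} (H : Set (𝒳 → Fin 2)) (n : ℕ) : ℝ :=
  ⨆ x : Fin n → 𝒳,
    (2 ^ n : ℝ)⁻¹ * ∑ σ : Fin n → ℤˣ,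
      ⨆ h : H, |(n : ℝ)⁻¹ * ∑ i, ((σ i : ℤ) : ℝ) * ((h.1 (x i) : ℕ) : ℝ)|

/-- Linear fairness constraints `M μ(h) ≤ c` on conditional moments
`μ_j(h) = E[g_j(X, A, Y, h(X)) | E_j]`. -/
structure Constraints (𝒳 𝒜 J K : Type*) [MeasurableSpace 𝒳] [MeasurableSpace 𝒜] where
  /-- the moment functions; the last argument is the prediction -/
  g : J → Point 𝒳 𝒜 → Fin 2 → ℝ
  /-- the conditioning events -/
  E : J → Set (Point 𝒳 𝒜)
  /-- the constraint matrix -/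
  M : Matrix K J ℝ
  /-- the right-hand side -/
  c : K → ℝ
  measurable_g : ∀ j, Measurable (Function.uncurry (g j))
  g_mem : ∀ j z y, g j z y ∈ Set.Icc (0 : ℝ) 1
  measurableSet_E : ∀ j, MeasurableSet (E j)

/-- The value `∑_h Q(h) f(h)` of a randomized classifier `Q`. -/
def mix {𝒳 : Type*} {H : Set (𝒳 → Fin 2)} (Q : PMF H) (f : (𝒳 → Fin 2) → ℝ) : ℝ :=
  ∑' h : H, (Q h).toReal * f h.1

/-- Measurability of the suprema over `H` of weighted, shifted empirical sums: they are random
variables. (Automatic if `H` is countable; some such requirement is needed for uncountable `H`.) -/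
def SupMeasurable {𝒳 𝒜 : Type*} [MeasurableSpace 𝒳] [MeasurableSpace 𝒜]
    (H : Set (𝒳 → Fin 2)) (D : Measure (Point 𝒳 𝒜)) : Prop :=
  ∀ f : Point 𝒳 𝒜 → Fin 2 → ℝ, Measurable (Function.uncurry f) →
    (∀ z y, f z y ∈ Set.Icc (0 : ℝ) 1) →
    ∀ (m : ℕ) (a : Fin m → ℝ) (b : ℝ),
      Measurable fun z : Fin m → Point 𝒳 𝒜 =>
        ⨆ h : H, |∑ i, a i * f (z i) (h.1 (z i).1) + b * ∫ w, f w (h.1 w.1) ∂D|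

section Population

variable {𝒳 𝒜 J K : Type*} [MeasurableSpace 𝒳] [MeasurableSpace 𝒜] {H : Set (𝒳 → Fin 2)}

/-- `err(h) = P[h(X) ≠ Y]`. -/
def err (D : Measure (Point 𝒳 𝒜)) (h : 𝒳 → Fin 2) : ℝ :=
  D.real {z | h z.1 ≠ z.2.2}

/-- `μ_j(h) = E[g_j(X, A, Y, h(X)) | E_j]`. -/
def moment (F : Constraints 𝒳 𝒜 J K) (D : Measure (Point 𝒳 𝒜)) (j : J) (h : 𝒳 → Fin 2) : ℝ :=
  ∫ z, F.g j z (h z.1) ∂(ProbabilityTheory.cond D (F.E j))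

/-- `err(Q)` for a randomized classifier. -/
def errQ (D : Measure (Point 𝒳 𝒜)) (Q : PMF H) : ℝ := mix Q (err D)

/-- `γ_k(Q) = ∑_j M_{k,j} μ_j(Q)` for a randomized classifier. -/
def gammaQ [Fintype J] (F : Constraints 𝒳 𝒜 J K) (D : Measure (Point 𝒳 𝒜)) (Q : PMF H)
    (k : K) : ℝ :=
  ∑ j, F.M k j * mix Q (moment F D j)

/-- `Q` minimizes `err` over all randomized classifiers subject to `M μ(Q) ≤ c`. -/
def IsOptimal [Fintype J] (F : Constraints 𝒳 𝒜 J K) (D : Measure (Point 𝒳 𝒜))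
    (Q : PMF H) : Prop :=
  (∀ k, gammaQ F D Q k ≤ F.c k) ∧
    ∀ Q' : PMF H, (∀ k, gammaQ F D Q' k ≤ F.c k) → errQ D Q ≤ errQ D Q'

end Population

section Empirical

variable {𝒳 𝒜 J K : Type*} [MeasurableSpace 𝒳] [MeasurableSpace 𝒜] {H : Set (𝒳 → Fin 2)} {n : ℕ}

open Classical in
/-- The indices of the data points that fall in `E_j`. -/
def idx (F : Constraints 𝒳 𝒜 J K) (S : Fin n → Point 𝒳 𝒜) (j : J) : Finset (Fin n) :=
  Finset.univ.filter fun i => S i ∈ F.E j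

/-- `n_j`, the number of data points that fall in `E_j`. -/
def count (F : Constraints 𝒳 𝒜 J K) (S : Fin n → Point 𝒳 𝒜) (j : J) : ℕ := (idx F S j).card

/-- The empirical error of a classifier. -/
def empErr (S : Fin n → Point 𝒳 𝒜) (h : 𝒳 → Fin 2) : ℝ :=
  (n : ℝ)⁻¹ * ∑ i, if h (S i).1 ≠ (S i).2.2 then 1 else 0

/-- The empirical conditional moment of a classifier, meaningful if `n_j > 0`. -/
def empMoment (F : Constraints 𝒳 𝒜 J K) (S : Fin n → Point 𝒳 𝒜) (j : J) (h : 𝒳 → Fin 2) : ℝ :=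
  (count F S j : ℝ)⁻¹ * ∑ i ∈ idx F S j, F.g j (S i) (h (S i).1)

/-- The empirical error of a randomized classifier. -/
def empErrQ (S : Fin n → Point 𝒳 𝒜) (Q : PMF H) : ℝ := mix Q (empErr S)

/-- The empirical constraint values `M μ̂(Q)` of a randomized classifier. -/
def empGammaQ [Fintype J] (F : Constraints 𝒳 𝒜 J K) (S : Fin n → Point 𝒳 𝒜) (Q : PMF H)
    (k : K) : ℝ :=
  ∑ j, F.M k j * mix Q (empMoment F S j)

/-- `ε_k = C' ∑_j |M_{k,j}| n_j^{-α}`. -/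
def slack [Fintype J] (F : Constraints 𝒳 𝒜 J K) (S : Fin n → Point 𝒳 𝒜) (C' α : ℝ) (k : K) : ℝ :=
  C' * ∑ j, |F.M k j| * (count F S j : ℝ) ^ (-α)

/-- The Lagrangian `L(Q, l) = êrr(Q) + lᵀ (M μ̂(Q) - ĉ)` for given relaxed bounds `ĉ`. -/
def lagrangian [Fintype J] [Fintype K] (F : Constraints 𝒳 𝒜 J K) (S : Fin n → Point 𝒳 𝒜)
    (chat : K → ℝ) (Q : PMF H) (l : K → ℝ) : ℝ :=
  empErrQ S Q + ∑ k, l k * (empGammaQ F S Q k - chat k)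

/-- The admissible multipliers: `l ≥ 0` with `‖l‖₁ ≤ B`. -/
def multipliers (K : Type*) [Fintype K] (B : ℝ) : Set (K → ℝ) :=
  {l | (∀ k, 0 ≤ l k) ∧ ∑ k, |l k| ≤ B}

/-- `(Q, l)` is a `ν`-approximate saddle point of the Lagrangian. -/
def IsApproxSaddle [Fintype J] [Fintype K] (F : Constraints 𝒳 𝒜 J K) (S : Fin n → Point 𝒳 𝒜)
    (chat : K → ℝ) (B ν : ℝ) (Q : PMF H) (l : K → ℝ) : Prop :=
  l ∈ multipliers K B ∧
    (∀ Q' : PMF H, lagrangian F S chat Q l ≤ lagrangian F S chat Q' l + ν) ∧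
    ∀ l' ∈ multipliers K B, lagrangian F S chat Q l' - ν ≤ lagrangian F S chat Q l

end Empirical

end FairClass

end

/-! The argument separates a deterministic saddle-point comparison from a uniform convergence
statement.

Deterministic part. Suppose the empirical error and all empirical moments are uniformly close to
their expectations over `H`, hence over all mixtures. Since the slack dominates the moment
deviations, the optimum `Qstar` is feasible for the relaxed empirical constraints, so its penalty in
the Lagrangian is nonpositive. Testing the saddle point against the multiplier 0 bounds the
empirical error. Testing it against `B` times a unit vector bounds each empirical violation by `(1 +
2ν)/B`, because empirical errors lie in [0,1]. Returning to the population costs one more deviation,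
which explains the factors 2.

Uniform convergence. McDiarmid's inequality (`bounded_differences_inequality`) and symmetrization
(`integral_deviation_le`) reduce it to a Rademacher average. A function of the data point and a 0/1
prediction is affine in the prediction. Its slope is in [-1,1] and is removed by contraction; its
intercept does not depend on `h` and contributes at most `1/√m`. As `α ≤ 1/2`, this is absorbed into
`m ^ (-α)` (`measure_deviation_classifier_le`).

The sample size `n_j` of a conditional moment is random. Given exactly which indices fall in `E_j`,
those points are i.i.d. from the conditional law, so the fixed-size bound applies on each such
piece. Averaging over the pieces costs nothing (`exists_uniform_moment_event`). A Chernoff bound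
then replaces `n_j` by half its expectation. Negative `α` is treated separately in the last bound,
where it is trivial. -/

noncomputable section

namespace FairClass

/-! ### McDiarmid's inequality. -/

section BoundedDifferences

variable {α : Type*} [MeasurableSpace α]

lemma integrable_of_abs_le {μ : Measure α} [IsFiniteMeasure μ] {X : α → ℝ} {b : ℝ}
    (hX : Measurable X) (hb : ∀ z, |X z| ≤ b) : Integrable X μ :=
  Integrable.of_bound hX.aestronglyMeasurable b (Filter.Eventually.of_forall hb)

lemma integrable_exp_mul_of_abs_le {μ : Measure α} [IsFiniteMeasure μ] {X : α → ℝ} {b : ℝ}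
    (hX : Measurable X) (hb : ∀ z, |X z| ≤ b) (t : ℝ) :
    Integrable (fun z => Real.exp (t * X z)) μ :=
  integrable_exp_mul_of_mem_Icc (a := -b) (b := b) hX.aemeasurable
    (Filter.Eventually.of_forall fun z => abs_le.1 (hb z))

/-- Hoeffding's lemma for a function of oscillation at most `c`. -/
lemma mgf_le_of_oscillation (μ : Measure α) [IsProbabilityMeasure μ] {X : α → ℝ}
    (hX : Measurable X) {c : ℝ} (hosc : ∀ z z', |X z - X z'| ≤ c) (t : ℝ) :
    mgf (fun z => X z - ∫ w, X w ∂μ) μ t ≤ Real.exp ((c / 2) ^ 2 * t ^ 2 / 2) := by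
  obtain ⟨z₀⟩ : Nonempty α := nonempty_of_isProbabilityMeasure μ
  have hc : 0 ≤ c := (abs_nonneg _).trans (hosc z₀ z₀)
  -- An oscillation bound places all values in an interval of length `c` starting at the infimum, so
  -- Hoeffding's lemma applies.
  have hbdd : BddBelow (Set.range X) :=
    ⟨X z₀ - c, by rintro _ ⟨z, rfl⟩; have := abs_le.1 (hosc z z₀); linarith [this.1]⟩
  have : Nonempty α := ⟨z₀⟩
  have hmem : ∀ z, X z ∈ Set.Icc (⨅ w, X w) ((⨅ w, X w) + c) := fun z => by
    refine ⟨ciInf_le hbdd z, ?_⟩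
    have : X z - c ≤ ⨅ w, X w := le_ciInf fun w => by
      have := abs_le.1 (hosc z w); linarith [this.2]
    linarith
  have := (hasSubgaussianMGF_of_mem_Icc (μ := μ) hX.aemeasurable
    (Filter.Eventually.of_forall hmem)).mgf_le t
  simpa [abs_of_nonneg hc] using this

/-- Induction on the number of coordinates: freeze the first one, apply the induction hypothesis to
the rest, then apply Hoeffding's lemma to the partial mean. The variance proxies `(c / 2) ^ 2` add
up; the bound `b` serves only integrability. -/
lemma mgf_le_of_bounded_differences (μ : Measure α) [IsProbabilityMeasure μ] {c b : ℝ} (t : ℝ)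
    (n : ℕ) (Φ : (Fin n → α) → ℝ) (hΦ : Measurable Φ) (hb : ∀ z, |Φ z| ≤ b)
    (hd : ∀ z i y, |Φ (Function.update z i y) - Φ z| ≤ c) :
    mgf (fun z => Φ z - ∫ w, Φ w ∂(Measure.pi fun _ => μ)) (Measure.pi fun _ => μ) t
      ≤ Real.exp (n * (c / 2) ^ 2 * t ^ 2 / 2) := by
  induction n with
  | zero =>
    have hconst : ∀ z, Φ z = Φ default := fun z => by rw [Subsingleton.elim z default]
    simp [mgf, hconst]
  | succ n ih =>
    let e := MeasurableEquiv.piFinSuccAbove (fun _ : Fin (n + 1) => α) 0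
    have he : MeasurePreserving e (Measure.pi fun _ => μ) (μ.prod (Measure.pi fun _ => μ)) :=
      measurePreserving_piFinSuccAbove (fun _ => μ) 0
    let Ψ : α → (Fin n → α) → ℝ := fun x y => Φ (Fin.cons x y)
    have hcons : Measurable fun p : α × (Fin n → α) => (Fin.cons p.1 p.2 : Fin (n + 1) → α) := by
      refine measurable_pi_iff.2 fun i => ?_
      refine Fin.cases ?_ (fun j => ?_) i
      · simpa using measurable_fst
      · simp only [Fin.cons_succ]; fun_prop
    have hΨ : Measurable (Function.uncurry Ψ) := hΦ.comp hcons
    have hΦe : ∀ z, Φ z = Ψ (e z).1 (e z).2 := fun z => by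
      have : (Fin.cons (e z).1 (e z).2 : Fin (n + 1) → α) = z := by
        funext i
        refine Fin.cases ?_ (fun j => ?_) i <;> simp [e, MeasurableEquiv.piFinSuccAbove]
        rfl
      simp only [Ψ, this]
    let g : α → ℝ := fun x => ∫ y, Ψ x y ∂(Measure.pi fun _ => μ)
    have hg : Measurable g := hΨ.stronglyMeasurable.integral_prod_right.measurable
    have hΨx : ∀ x, Measurable (Ψ x) := fun x => hΨ.comp measurable_prodMk_left
    have hint : Integrable (Function.uncurry Ψ) (μ.prod (Measure.pi fun _ => μ)) :=
      integrable_of_abs_le hΨ fun p => hb _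
    have hmean : ∫ w, Φ w ∂(Measure.pi fun _ => μ) = ∫ x, g x ∂μ := by
      rw [show ∫ x, g x ∂μ = ∫ p, Function.uncurry Ψ p ∂(μ.prod (Measure.pi fun _ => μ)) from
        (integral_prod _ hint).symm, ← he.integral_comp e.measurableEmbedding]
      exact integral_congr_ae (Filter.Eventually.of_forall hΦe)
    -- Averaging over the remaining coordinates preserves the bound on the effect of changing the
    -- first one.
    have hosc : ∀ x x', |g x - g x'| ≤ c := fun x x' => by
      have hi : ∀ x, Integrable (Ψ x) (Measure.pi fun _ => μ) := fun x =>
        integrable_of_abs_le (hΨx x) fun y => hb _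
      have hp : ∀ y, |Ψ x y - Ψ x' y| ≤ c := fun y => by
        have := hd (Fin.cons x' y) 0 x
        simpa [Ψ, Fin.update_cons_zero] using this
      have := norm_integral_le_of_norm_le_const (μ := Measure.pi fun _ : Fin n => μ)
        (f := fun y => Ψ x y - Ψ x' y) (Filter.Eventually.of_forall hp)
      rw [integral_sub (hi x) (hi x')] at this
      simpa [g] using this
    have hgb : ∀ x, |g x| ≤ b := fun x => by
      have := norm_integral_le_of_norm_le_const (μ := Measure.pi fun _ : Fin n => μ)
        (f := Ψ x) (C := b) (Filter.Eventually.of_forall fun y => hb _)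
      simpa [g] using this
    set m := ∫ x, g x ∂μ with hm
    have hinner : ∀ x, ∫ y, Real.exp (t * (Ψ x y - m)) ∂(Measure.pi fun _ => μ)
        ≤ Real.exp (n * (c / 2) ^ 2 * t ^ 2 / 2) * Real.exp (t * (g x - m)) := fun x => by
      have h1 := ih (Ψ x) (hΨx x) (fun y => hb _) (fun y i v => by
        have := hd (Fin.cons x y) i.succ v
        simpa [Ψ, Fin.cons_update] using this)
      have h2 : ∀ y, Real.exp (t * (Ψ x y - m))
          = Real.exp (t * (Ψ x y - g x)) * Real.exp (t * (g x - m)) := fun y => by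
        rw [← Real.exp_add]; ring_nf
      simp_rw [h2]
      rw [integral_mul_const]
      exact mul_le_mul_of_nonneg_right h1 (Real.exp_pos _).le
    have hexp : Integrable (fun p : α × (Fin n → α) => Real.exp (t * (Ψ p.1 p.2 - m)))
        (μ.prod (Measure.pi fun _ => μ)) :=
      integrable_exp_mul_of_abs_le (b := b + |m|) (hΨ.sub_const m)
        (fun p => (abs_sub _ _).trans (add_le_add_left (hb _) _)) t
    calc mgf (fun z => Φ z - ∫ w, Φ w ∂(Measure.pi fun _ => μ)) (Measure.pi fun _ => μ) t
        = ∫ p, Real.exp (t * (Ψ p.1 p.2 - m)) ∂(μ.prod (Measure.pi fun _ => μ)) := by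
          rw [← he.integral_comp e.measurableEmbedding, mgf, hmean]
          exact integral_congr_ae (Filter.Eventually.of_forall fun z => by simp only [hΦe z])
      _ = ∫ x, ∫ y, Real.exp (t * (Ψ x y - m)) ∂(Measure.pi fun _ => μ) ∂μ :=
          integral_prod _ hexp
      _ ≤ ∫ x, Real.exp (n * (c / 2) ^ 2 * t ^ 2 / 2) * Real.exp (t * (g x - m)) ∂μ := by
          refine integral_mono hexp.integral_prod_left ?_ hinner
          exact (integrable_exp_mul_of_abs_le (b := b + |m|) (hg.sub_const m)
            (fun p => (abs_sub _ _).trans (add_le_add_left (hgb _) _)) t).const_mul _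
      _ = Real.exp (n * (c / 2) ^ 2 * t ^ 2 / 2) * mgf (fun x => g x - ∫ w, g w ∂μ) μ t := by
          rw [integral_const_mul, mgf]
      _ ≤ Real.exp (n * (c / 2) ^ 2 * t ^ 2 / 2) * Real.exp ((c / 2) ^ 2 * t ^ 2 / 2) :=
          mul_le_mul_of_nonneg_left (mgf_le_of_oscillation μ hg hosc t) (Real.exp_pos _).le
      _ = Real.exp ((n + 1 : ℕ) * (c / 2) ^ 2 * t ^ 2 / 2) := by
          rw [← Real.exp_add]; push_cast; ring_nf

/-- McDiarmid's inequality for an average-like function of `n ≥ 1` i.i.d. points: if changing one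
coordinate changes `Φ` by at most `1 / n`, the deviation probability is at most `exp (-2 n t²)`. -/
theorem bounded_differences_inequality (μ : Measure α) [IsProbabilityMeasure μ] {b : ℝ}
    {n : ℕ} (hn : 1 ≤ n) (Φ : (Fin n → α) → ℝ) (hΦ : Measurable Φ) (hb : ∀ z, |Φ z| ≤ b)
    (hd : ∀ z i y, |Φ (Function.update z i y) - Φ z| ≤ (n : ℝ)⁻¹) {t : ℝ} (ht : 0 ≤ t) :
    (Measure.pi fun _ => μ).real {z | t ≤ Φ z - ∫ w, Φ w ∂(Measure.pi fun _ => μ)}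
      ≤ Real.exp (-2 * n * t ^ 2) := by
  have hn0 : (0 : ℝ) < n := by exact_mod_cast hn
  set m := ∫ w, Φ w ∂(Measure.pi fun _ : Fin n => μ)
  -- With `c = 1/n` the proxy is `n * (1/(2n))^2 = 1/(4n)`.
  have hs : HasSubgaussianMGF (fun z => Φ z - m) (4 * (n : NNReal))⁻¹ (Measure.pi fun _ => μ) :=
    { integrable_exp_mul := integrable_exp_mul_of_abs_le (b := b + |m|) (hΦ.sub_const m)
        (fun p => (abs_sub _ _).trans (add_le_add_left (hb _) _))
      mgf_le := fun s => by
        refine (mgf_le_of_bounded_differences μ s n Φ hΦ hb hd).trans (le_of_eq ?_)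
        congr 1
        push_cast
        field_simp
        ring }
  refine (hs.measure_ge_le ht).trans (le_of_eq ?_)
  congr 1
  push_cast
  field_simp
  norm_num

end BoundedDifferences

/-! ### Lower tail of the number of points in an event. -/

section Chernoff

variable {α : Type*} [MeasurableSpace α]

open Classical in
/-- The lower-tail multiplicative Chernoff bound for the number of points in `E`. -/
theorem card_filter_le_half (μ : Measure α) [IsProbabilityMeasure μ] {E : Set α}
    (hE : MeasurableSet E) (n : ℕ) :
    (Measure.pi fun _ : Fin n => μ).real
      {z | ((Finset.univ.filter fun i => z i ∈ E).card : ℝ) ≤ n * μ.real E / 2}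
      ≤ Real.exp (-(n * μ.real E) / 8) := by
  set p := μ.real E
  set X : (Fin n → α) → ℝ := fun z => ((Finset.univ.filter fun i => z i ∈ E).card : ℝ)
  have hu : Measurable (E.indicator fun _ => (1 : ℝ)) := measurable_const.indicator hE
  have hXs : ∀ z, X z = ∑ i, E.indicator (fun _ => (1 : ℝ)) (z i) := fun z => by
    simp [X, Set.indicator_apply]
  have hX : Measurable X := by
    rw [show X = _ from funext hXs]
    exact Finset.measurable_sum _ fun i _ => hu.comp (measurable_pi_apply i)
  have hXb : ∀ z, |X z| ≤ n := fun z => by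
    simp only [X, Nat.abs_cast]
    exact_mod_cast (Finset.card_le_univ _).trans (by simp)
  -- The tilt `-log 2` turns the exponential into `2 ^ (-X)`, with mean `(1 - p/2)^n`. The final
  -- exponent is `-(1 - log 2) n p / 2`, and `(1 - log 2)/2 > 1/8`.
  have hmgf : mgf X (Measure.pi fun _ => μ) (-Real.log 2) ≤ Real.exp (-(n * p) / 2) := by
    have h1 : ∀ z, Real.exp (-Real.log 2 * X z)
        = ∏ i, (1 - E.indicator (fun _ => (1 : ℝ)) (z i) / 2) := fun z => by
      rw [hXs, Finset.mul_sum, Real.exp_sum]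
      refine Finset.prod_congr rfl fun i _ => ?_
      by_cases h : z i ∈ E
      · simp [h, Real.exp_neg, Real.exp_log]; norm_num
      · simp [h]
    rw [mgf]
    simp_rw [h1]
    rw [integral_fintype_prod_eq_pow (fun x => 1 - E.indicator (fun _ => (1 : ℝ)) x / 2)]
    have h2 : ∫ x, (1 - E.indicator (fun _ => (1 : ℝ)) x / 2) ∂μ = 1 - p / 2 := by
      rw [integral_sub (integrable_const _)
        (((integrable_const (1 : ℝ)).indicator hE).div_const 2), integral_div,
        integral_indicator_const _ hE]
      simp [p]
    rw [h2, Fintype.card_fin]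
    have hp : p ≤ 1 := measureReal_le_one
    calc (1 - p / 2) ^ n ≤ (Real.exp (-(p / 2))) ^ n :=
          pow_le_pow_left₀ (by linarith) (Real.one_sub_le_exp_neg _) n
      _ = Real.exp (-(n * p) / 2) := by rw [← Real.exp_nat_mul]; ring_nf
  refine (measure_le_le_exp_mul_mgf (n * p / 2) (neg_nonpos.2 (Real.log_nonneg one_le_two))
    (integrable_exp_mul_of_abs_le hX hXb _)).trans ?_
  refine (mul_le_mul_of_nonneg_left hmgf (Real.exp_pos _).le).trans ?_
  rw [← Real.exp_add, Real.exp_le_exp]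
  have hp : 0 ≤ n * p := mul_nonneg n.cast_nonneg measureReal_nonneg
  nlinarith [Real.log_two_lt_d9]

end Chernoff

/-! ### Conditioning an i.i.d. sample on which points fall in an event. -/

section Conditioning

variable {α : Type*} [MeasurableSpace α]

/-- Conditioning a product measure on a box of positive measure conditions every factor. -/
lemma cond_pi_univ_pi {ι : Type*} [Fintype ι] (μ : Measure α) [IsProbabilityMeasure μ]
    {S : ι → Set α} (hS : ∀ i, MeasurableSet (S i)) (hpos : ∀ i, μ (S i) ≠ 0) :
    ProbabilityTheory.cond (Measure.pi fun _ => μ) (Set.univ.pi S)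
      = Measure.pi fun i => ProbabilityTheory.cond μ (S i) := by
  have : ∀ i, IsProbabilityMeasure (ProbabilityTheory.cond μ (S i)) := fun i =>
    cond_isProbabilityMeasure (hpos i)
  refine (Measure.pi_eq fun s hs => ?_).symm
  rw [cond_apply (MeasurableSet.univ_pi hS), ← Set.pi_inter_distrib, Measure.pi_pi, Measure.pi_pi,
    ENNReal.prod_inv_distrib, ← Finset.prod_mul_distrib]
  · exact Finset.prod_congr rfl fun i _ => (cond_apply (hS i) _ _).symm
  · exact fun i _ j _ _ => Or.inl (hpos i)

/-- Restricting i.i.d. coordinates along an injection yields i.i.d. coordinates. -/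
lemma pi_map_comp_injective {ι κ : Type*} [Fintype ι] [Fintype κ] (μ : ι → Measure α)
    [∀ i, IsProbabilityMeasure (μ i)] {e : κ → ι} (he : Function.Injective e) :
    (Measure.pi μ).map (fun z k => z (e k)) = Measure.pi fun k => μ (e k) := by
  have h := (iIndepFun_pi (μ := μ) (X := fun _ x => x) fun i => aemeasurable_id).precomp he
  rw [iIndepFun_iff_map_fun_eq_pi_map fun i => (measurable_pi_apply (e i)).aemeasurable] at h
  refine h.trans ?_
  congr 1
  funext k
  exact (measurePreserving_eval μ (e k)).map_eq

/-- Given that exactly the coordinates in the range of `e` fall in `E`, these coordinates are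
i.i.d. with law `cond μ E`. -/
lemma measure_forall_mem_iff_inter_le (μ : Measure α) [IsProbabilityMeasure μ] {E : Set α}
    (hE : MeasurableSet E) {n m : ℕ} (hm : 1 ≤ m) {e : Fin m → Fin n} (he : Function.Injective e)
    {T : Set (Fin m → α)} (hT : MeasurableSet T) {q : ENNReal}
    (hq : μ E ≠ 0 → (Measure.pi fun _ => ProbabilityTheory.cond μ E) T ≤ q) :
    (Measure.pi fun _ : Fin n => μ)
        ({z | ∀ i, z i ∈ E ↔ i ∈ Set.range e} ∩ {z | (fun k => z (e k)) ∈ T})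
      ≤ q * (Measure.pi fun _ : Fin n => μ) {z | ∀ i, z i ∈ E ↔ i ∈ Set.range e} := by
  classical
  -- Fixing which points lie in `E` is a box event with sides `E` and `Eᶜ`, so conditioning on it
  -- keeps the coordinates independent.
  let S : Fin n → Set α := fun i => if i ∈ Set.range e then E else Eᶜ
  have hS : ∀ i, MeasurableSet (S i) := fun i => by
    simp only [S]; split_ifs
    exacts [hE, hE.compl]
  have hA : {z : Fin n → α | ∀ i, z i ∈ E ↔ i ∈ Set.range e} = Set.univ.pi S := by
    ext z
    simp only [Set.mem_ofPred_eq, Set.mem_univ_pi, S]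
    refine forall_congr' fun i => ?_
    split_ifs with h <;> simp [h]
  rw [hA]
  by_cases h0 : ∀ i, μ (S i) ≠ 0
  -- Here `1 ≤ m` matters: some side of the box is `E` itself.
  · have hμE : μ E ≠ 0 := by
      have := h0 (e ⟨0, hm⟩)
      simpa [S] using this
    have : ∀ i, IsProbabilityMeasure (ProbabilityTheory.cond μ (S i)) := fun i =>
      cond_isProbabilityMeasure (h0 i)
    have hproj : Measurable fun (z : Fin n → α) k => z (e k) := by fun_prop
    have key : ProbabilityTheory.cond (Measure.pi fun _ : Fin n => μ) (Set.univ.pi S)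
        {z | (fun k => z (e k)) ∈ T} ≤ q := by
      rw [cond_pi_univ_pi μ hS h0]
      refine le_trans (le_of_eq ?_) (hq hμE)
      have h := congrArg (fun ρ => ρ T)
        (pi_map_comp_injective (fun i => ProbabilityTheory.cond μ (S i)) he)
      simp only [Measure.map_apply hproj hT] at h
      refine h.trans ?_
      simp [S]
    rw [← cond_mul_eq_inter (MeasurableSet.univ_pi hS)]
    gcongr
  · push Not at h0
    obtain ⟨i, hi⟩ := h0
    have : (Measure.pi fun _ : Fin n => μ) (Set.univ.pi S) = 0 := by
      rw [Measure.pi_pi]; exact Finset.prod_eq_zero (Finset.mem_univ i) hi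
    exact (measure_mono Set.inter_subset_left).trans (by rw [this]; exact bot_le)

end Conditioning

/-! ### Random signs: second moments and contraction. -/

section Signs

lemma abs_sign (s : ℤˣ) : |((s : ℤ) : ℝ)| = 1 := by
  rcases Int.units_eq_one_or s with rfl | rfl <;> simp

lemma abs_average_le {n : ℕ} {a : Fin n → ℝ} (ha : ∀ i, |a i| ≤ 1) :
    |(n : ℝ)⁻¹ * ∑ i, a i| ≤ 1 := by
  rw [abs_mul, abs_inv, Nat.abs_cast]
  have h : |∑ i, a i| ≤ n := (Finset.abs_sum_le_sum_abs _ _).trans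
    ((Finset.sum_le_sum fun i _ => ha i).trans (by simp))
  exact inv_mul_le_one_of_le₀ h n.cast_nonneg

lemma abs_signed_average_le {n : ℕ} (σ : Fin n → ℤˣ) {a : Fin n → ℝ} (ha : ∀ i, |a i| ≤ 1) :
    |(n : ℝ)⁻¹ * ∑ i, ((σ i : ℤ) : ℝ) * a i| ≤ 1 :=
  abs_average_le fun i => by rw [abs_mul, abs_sign, one_mul]; exact ha i

lemma bddAbove_signed_average {ι : Type*} {n : ℕ} (σ : Fin n → ℤˣ) {b : ι → Fin n → ℝ}
    (hb : ∀ h i, |b h i| ≤ 1) :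
    BddAbove (Set.range fun h => |(n : ℝ)⁻¹ * ∑ i, ((σ i : ℤ) : ℝ) * b h i|) :=
  ⟨1, by rintro _ ⟨h, rfl⟩; exact abs_signed_average_le σ (hb h)⟩

lemma card_signs (n : ℕ) : Fintype.card (Fin n → ℤˣ) = 2 ^ n := by
  simp

/-- Distinct coordinates of a random sign vector are uncorrelated. -/
lemma sum_signs_sq (n : ℕ) (a : Fin n → ℝ) :
    ∑ σ : Fin n → ℤˣ, (∑ i, ((σ i : ℤ) : ℝ) * a i) ^ 2 = 2 ^ n * ∑ i, a i ^ 2 := by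
  induction n with
  | zero => simp
  | succ n ih =>
    rw [← (Fin.consEquiv fun _ : Fin (n + 1) => ℤˣ).sum_comp, Fintype.sum_prod_type,
      UnitsInt.univ, Finset.sum_pair (by decide), ← Finset.sum_add_distrib]
    -- Summing over the first sign cancels the cross term: `(x + y)^2 + (-x + y)^2 = 2x^2 + 2y^2`.
    have h : ∀ τ : Fin n → ℤˣ,
        (∑ i, (((Fin.consEquiv (fun _ : Fin (n + 1) => ℤˣ) (1, τ) i : ℤˣ) : ℤ) : ℝ) * a i) ^ 2
          + (∑ i, (((Fin.consEquiv (fun _ : Fin (n + 1) => ℤˣ) (-1, τ) i : ℤˣ) : ℤ) : ℝ) * a i) ^ 2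
          = 2 * a 0 ^ 2 + 2 * (∑ i, ((τ i : ℤ) : ℝ) * a i.succ) ^ 2 := fun τ => by
      simp only [Fin.consEquiv_apply, Fin.sum_univ_succ, Fin.cons_zero, Fin.cons_succ]
      push_cast
      ring
    rw [Finset.sum_congr rfl fun τ _ => h τ, Finset.sum_add_distrib, ← Finset.mul_sum, ← Finset.mul_sum, ih,
      Fin.sum_univ_succ]
    simp
    ring

/-- A Khinchin-type inequality. -/
lemma average_abs_signed_average_le {n : ℕ} (hn : 1 ≤ n) {a : Fin n → ℝ}
    (ha : ∀ i, |a i| ≤ 1) :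
    (2 ^ n : ℝ)⁻¹ * ∑ σ : Fin n → ℤˣ, |(n : ℝ)⁻¹ * ∑ i, ((σ i : ℤ) : ℝ) * a i| ≤ (√n)⁻¹ := by
  have hn0 : (0 : ℝ) < n := by exact_mod_cast hn
  have hsq : ∑ i, a i ^ 2 ≤ (n : ℝ) :=
    (Finset.sum_le_sum fun i _ => (sq_le_one_iff_abs_le_one _).2 (ha i)).trans (by simp)
  -- Cauchy–Schwarz over the `2 ^ n` sign vectors reduces the first moment to the second.
  have hcs : (∑ σ : Fin n → ℤˣ, |∑ i, ((σ i : ℤ) : ℝ) * a i|) ^ 2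
      ≤ (2 ^ n) ^ 2 * n := by
    refine (sq_sum_le_card_mul_sum_sq).trans ?_
    simp_rw [sq_abs]
    rw [sum_signs_sq, Finset.card_univ, card_signs]
    push_cast
    rw [← mul_assoc, ← sq]
    gcongr
  have hle : ∑ σ : Fin n → ℤˣ, |∑ i, ((σ i : ℤ) : ℝ) * a i| ≤ 2 ^ n * √n := by
    refine (Real.le_sqrt_of_sq_le hcs).trans (le_of_eq ?_)
    rw [Real.sqrt_mul (by positivity), Real.sqrt_sq (by positivity)]
  simp_rw [abs_mul, abs_inv, Nat.abs_cast]
  rw [← Finset.mul_sum]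
  calc (2 ^ n : ℝ)⁻¹ * ((n : ℝ)⁻¹ * ∑ σ : Fin n → ℤˣ, |∑ i, ((σ i : ℤ) : ℝ) * a i|)
      ≤ (2 ^ n : ℝ)⁻¹ * ((n : ℝ)⁻¹ * (2 ^ n * √n)) := by gcongr
    _ = (n : ℝ)⁻¹ * √n := by field_simp
    _ = (√n)⁻¹ := by
      have : (√n) ≠ 0 := (Real.sqrt_pos.2 hn0).ne'
      field_simp
      rw [Real.sq_sqrt hn0.le]

/-- The probability of the sign vector `τ` if its coordinates are independent with means `d`. -/
def signWeight {n : ℕ} (d : Fin n → ℝ) (τ : Fin n → ℤˣ) : ℝ :=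
  ∏ i, (1 + ((τ i : ℤ) : ℝ) * d i) / 2

lemma signWeight_nonneg {n : ℕ} {d : Fin n → ℝ} (hd : ∀ i, |d i| ≤ 1) (τ : Fin n → ℤˣ) :
    0 ≤ signWeight d τ :=
  Finset.prod_nonneg fun i _ => by
    have h : |((τ i : ℤ) : ℝ) * d i| ≤ 1 := by rw [abs_mul, abs_sign, one_mul]; exact hd i
    linarith [(abs_le.1 h).1]

lemma sum_signs_prod {n : ℕ} (F : Fin n → ℤˣ → ℝ) :
    ∑ τ : Fin n → ℤˣ, ∏ i, F i (τ i) = ∏ i, (F i 1 + F i (-1)) := by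
  have h : ∀ i, F i 1 + F i (-1) = ∑ s, F i s := fun i => by
    rw [UnitsInt.univ, Finset.sum_pair (by decide)]
  simp_rw [h]
  rw [Finset.prod_univ_sum, Fintype.piFinset_univ]

lemma sum_signWeight {n : ℕ} (d : Fin n → ℝ) : ∑ τ, signWeight d τ = 1 := by
  unfold signWeight
  rw [sum_signs_prod fun i s => (1 + ((s : ℤ) : ℝ) * d i) / 2]
  refine Finset.prod_eq_one fun i _ => ?_
  push_cast
  ring

/-- This represents multiplication by `d` as an average of random sign flips, the basis of the
contraction principle. -/
lemma sum_signWeight_mul {n : ℕ} (d : Fin n → ℝ) (j : Fin n) :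
    ∑ τ, signWeight d τ * ((τ j : ℤ) : ℝ) = d j := by
  have h : ∀ τ : Fin n → ℤˣ, signWeight d τ * ((τ j : ℤ) : ℝ)
      = ∏ i, ((1 + ((τ i : ℤ) : ℝ) * d i) / 2 * if i = j then ((τ i : ℤ) : ℝ) else 1) :=
    fun τ => by
      rw [Finset.prod_mul_distrib, Finset.prod_ite_eq' Finset.univ j, if_pos (Finset.mem_univ j)]
      rfl
  simp_rw [h]
  rw [sum_signs_prod fun i s => (1 + ((s : ℤ) : ℝ) * d i) / 2 * if i = j then ((s : ℤ) : ℝ) else 1,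
    Finset.prod_eq_single j]
  · simp
    ring
  · intro i _ hi
    simp [hi]
    ring
  · simp

/-- The contraction principle for coordinatewise multiplication by numbers in `[-1, 1]`. -/
lemma sum_signs_contraction {ι : Type*} [Nonempty ι] {n : ℕ} {d : Fin n → ℝ}
    (hd : ∀ i, |d i| ≤ 1) {b : ι → Fin n → ℝ} (hb : ∀ h i, |b h i| ≤ 1) :
    ∑ σ : Fin n → ℤˣ, ⨆ h, |(n : ℝ)⁻¹ * ∑ i, ((σ i : ℤ) : ℝ) * (d i * b h i)|
      ≤ ∑ σ : Fin n → ℤˣ, ⨆ h, |(n : ℝ)⁻¹ * ∑ i, ((σ i : ℤ) : ℝ) * b h i| := by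
  set S : (Fin n → ℤˣ) → ℝ := fun σ => ⨆ h, |(n : ℝ)⁻¹ * ∑ i, ((σ i : ℤ) : ℝ) * b h i|
  have hS : ∀ σ h, |(n : ℝ)⁻¹ * ∑ i, ((σ i : ℤ) : ℝ) * b h i| ≤ S σ := fun σ h =>
    le_ciSup (bddAbove_signed_average σ hb) h
  -- Replacing `d` by the mean of random signs `τ` and using convexity of the supremum gives an
  -- average over `τ`. Afterwards `σ * τ` is summed over all sign vectors for each fixed `τ`, so the
  -- flips disappear.
  have hstep : ∀ σ : Fin n → ℤˣ, ⨆ h, |(n : ℝ)⁻¹ * ∑ i, ((σ i : ℤ) : ℝ) * (d i * b h i)|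
      ≤ ∑ τ, signWeight d τ * S (σ * τ) := fun σ => by
    refine ciSup_le fun h => ?_
    have hrw : (n : ℝ)⁻¹ * ∑ i, ((σ i : ℤ) : ℝ) * (d i * b h i)
        = ∑ τ, signWeight d τ * ((n : ℝ)⁻¹ * ∑ i, (((σ * τ) i : ℤ) : ℝ) * b h i) := by
      simp_rw [← sum_signWeight_mul d, Finset.sum_mul, Finset.mul_sum]
      rw [Finset.sum_comm]
      refine Finset.sum_congr rfl fun τ _ => Finset.sum_congr rfl fun i _ => ?_
      simp only [Pi.mul_apply, Units.val_mul, Int.cast_mul]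
      ring
    rw [hrw]
    refine (Finset.abs_sum_le_sum_abs _ _).trans (Finset.sum_le_sum fun τ _ => ?_)
    rw [abs_mul, abs_of_nonneg (signWeight_nonneg hd τ)]
    exact mul_le_mul_of_nonneg_left (hS _ h) (signWeight_nonneg hd τ)
  refine (Finset.sum_le_sum fun σ _ => hstep σ).trans (le_of_eq ?_)
  rw [Finset.sum_comm]
  simp_rw [← Finset.mul_sum]
  have hshift : ∀ τ : Fin n → ℤˣ, ∑ σ, S (σ * τ) = ∑ σ, S σ := fun τ =>
    Equiv.sum_comp (Equiv.mulRight τ) S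
  simp_rw [hshift]
  rw [← Finset.sum_mul, sum_signWeight, one_mul]

end Signs

/-! ### From the complexity of the classifiers to that of the losses. -/

section Rademacher

variable {𝒳 𝒜 : Type*} {H : Set (𝒳 → Fin 2)}

lemma abs_label_le (y : Fin 2) : |((y : ℕ) : ℝ)| ≤ 1 := by
  rw [Nat.abs_cast]
  exact_mod_cast Nat.le_of_lt_succ y.2

lemma average_le_one {n : ℕ} {G : (Fin n → ℤˣ) → ℝ} (hG : ∀ σ, G σ ≤ 1) :
    (2 ^ n : ℝ)⁻¹ * ∑ σ, G σ ≤ 1 := by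
  refine inv_mul_le_one_of_le₀ ((Finset.sum_le_sum fun σ _ => hG σ).trans ?_) (by positivity)
  simp

lemma le_rademacher [Nonempty H] {n : ℕ} (x : Fin n → 𝒳) :
    (2 ^ n : ℝ)⁻¹ * ∑ σ : Fin n → ℤˣ,
        ⨆ h : H, |(n : ℝ)⁻¹ * ∑ i, ((σ i : ℤ) : ℝ) * ((h.1 (x i) : ℕ) : ℝ)|
      ≤ rademacher H n := by
  refine le_ciSup (f := fun x : Fin n → 𝒳 => (2 ^ n : ℝ)⁻¹ * ∑ σ : Fin n → ℤˣ,
        ⨆ h : H, |(n : ℝ)⁻¹ * ∑ i, ((σ i : ℤ) : ℝ) * ((h.1 (x i) : ℕ) : ℝ)|) ⟨1, ?_⟩ x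
  rintro _ ⟨x, rfl⟩
  exact average_le_one fun σ => ciSup_le fun h =>
    abs_signed_average_le σ fun i => abs_label_le _

/-- The Rademacher complexity of `H` composed with a `[0, 1]`-valued function of the data point and
the prediction. -/
lemma rademacher_comp_le [Nonempty H] {n : ℕ} (hn : 1 ≤ n) {f : Point 𝒳 𝒜 → Fin 2 → ℝ}
    (hf : ∀ z y, f z y ∈ Set.Icc (0 : ℝ) 1) (z : Fin n → Point 𝒳 𝒜) :
    (2 ^ n : ℝ)⁻¹ * ∑ σ : Fin n → ℤˣ,
        ⨆ h : H, |(n : ℝ)⁻¹ * ∑ i, ((σ i : ℤ) : ℝ) * f (z i) (h.1 (z i).1)|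
      ≤ rademacher H n + (√n)⁻¹ := by
  set d : Fin n → ℝ := fun i => f (z i) 1 - f (z i) 0
  set b : H → Fin n → ℝ := fun h i => ((h.1 (z i).1 : ℕ) : ℝ)
  have hd : ∀ i, |d i| ≤ 1 := fun i => by
    have h0 := hf (z i) 0
    have h1 := hf (z i) 1
    exact abs_le.2 ⟨by simp only [d]; linarith [h0.2, h1.1], by simp only [d]; linarith [h0.1, h1.2]⟩
  have hb : ∀ h i, |b h i| ≤ 1 := fun h i => abs_label_le _
  have hdb : ∀ h i, |d i * b h i| ≤ 1 := fun h i => by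
    rw [abs_mul]; exact mul_le_one₀ (hd i) (abs_nonneg _) (hb h i)
  have h0 : ∀ i, |f (z i) 0| ≤ 1 := fun i => by
    rw [abs_of_nonneg (hf _ _).1]; exact (hf _ _).2
  -- A function on {0,1} is affine in its argument.
  have hsplit : ∀ (h : H) i, f (z i) (h.1 (z i).1) = f (z i) 0 + d i * b h i := fun h i => by
    simp only [d, b]
    generalize h.1 (z i).1 = y
    fin_cases y <;> simp
  have hstep : ∀ σ : Fin n → ℤˣ,
      ⨆ h : H, |(n : ℝ)⁻¹ * ∑ i, ((σ i : ℤ) : ℝ) * f (z i) (h.1 (z i).1)|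
        ≤ (⨆ h : H, |(n : ℝ)⁻¹ * ∑ i, ((σ i : ℤ) : ℝ) * (d i * b h i)|)
          + |(n : ℝ)⁻¹ * ∑ i, ((σ i : ℤ) : ℝ) * f (z i) 0| := fun σ => by
    refine ciSup_le fun h => ?_
    simp_rw [hsplit, mul_add, Finset.sum_add_distrib]
    rw [mul_add, add_comm]
    refine (abs_add_le _ _).trans (add_le_add_left ?_ _)
    exact le_ciSup (bddAbove_signed_average σ hdb) h
  calc (2 ^ n : ℝ)⁻¹ * ∑ σ : Fin n → ℤˣ,
        ⨆ h : H, |(n : ℝ)⁻¹ * ∑ i, ((σ i : ℤ) : ℝ) * f (z i) (h.1 (z i).1)|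
      ≤ (2 ^ n : ℝ)⁻¹ * ∑ σ : Fin n → ℤˣ,
          ((⨆ h : H, |(n : ℝ)⁻¹ * ∑ i, ((σ i : ℤ) : ℝ) * (d i * b h i)|)
          + |(n : ℝ)⁻¹ * ∑ i, ((σ i : ℤ) : ℝ) * f (z i) 0|) := by
        gcongr with σ _
        exact hstep σ
    _ = (2 ^ n : ℝ)⁻¹ * (∑ σ : Fin n → ℤˣ,
          ⨆ h : H, |(n : ℝ)⁻¹ * ∑ i, ((σ i : ℤ) : ℝ) * (d i * b h i)|)
        + (2 ^ n : ℝ)⁻¹ * ∑ σ : Fin n → ℤˣ, |(n : ℝ)⁻¹ * ∑ i, ((σ i : ℤ) : ℝ) * f (z i) 0| := by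
        rw [Finset.sum_add_distrib, mul_add]
    _ ≤ rademacher H n + (√n)⁻¹ := by
        refine add_le_add ?_ (average_abs_signed_average_le hn h0)
        refine le_trans ?_ (le_rademacher fun i => (z i).1)
        exact mul_le_mul_of_nonneg_left (sum_signs_contraction hd hb) (by positivity)

end Rademacher

/-! ### Symmetrization and concentration of the uniform deviation. -/

section UniformDeviation

variable {ι α : Type*}

/-- The uniform deviation of empirical averages from expectations. -/
def deviation [MeasurableSpace α] (μ : Measure α) (φ : ι → α → ℝ) {n : ℕ} (z : Fin n → α) : ℝ :=
  ⨆ h, |(n : ℝ)⁻¹ * ∑ i, φ h (z i) - ∫ w, φ h w ∂μ|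

/-- The symmetrized deviation of a sample of pairs. -/
def symmDeviation (φ : ι → α → ℝ) {n : ℕ} (σ : Fin n → ℤˣ) (w : Fin n → α × α) : ℝ :=
  ⨆ h, |(n : ℝ)⁻¹ * ∑ i, ((σ i : ℤ) : ℝ) * (φ h (w i).1 - φ h (w i).2)|

variable {φ : ι → α → ℝ} {n : ℕ}

lemma average_mem_unit {a : Fin n → ℝ} (ha : ∀ i, a i ∈ Set.Icc (0 : ℝ) 1) :
    (n : ℝ)⁻¹ * ∑ i, a i ∈ Set.Icc (0 : ℝ) 1 :=
  ⟨mul_nonneg (by positivity) (Finset.sum_nonneg fun i _ => (ha i).1),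
    (abs_le.1 (abs_average_le fun i => by rw [abs_of_nonneg (ha i).1]; exact (ha i).2)).2⟩

lemma abs_sub_le_one_of_mem_unit {x y : ℝ} (hx : x ∈ Set.Icc (0 : ℝ) 1)
    (hy : y ∈ Set.Icc (0 : ℝ) 1) : |x - y| ≤ 1 :=
  abs_le.2 ⟨by linarith [hx.1, hy.2], by linarith [hx.2, hy.1]⟩

lemma abs_symmDeviation_le [Nonempty ι] (hφ' : ∀ h z, φ h z ∈ Set.Icc (0 : ℝ) 1)
    (σ : Fin n → ℤˣ) (w : Fin n → α × α) : |symmDeviation φ σ w| ≤ 1 := by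
  rw [symmDeviation, abs_of_nonneg (Real.iSup_nonneg fun h => abs_nonneg _)]
  exact ciSup_le fun h => abs_signed_average_le σ fun i =>
    abs_sub_le_one_of_mem_unit (hφ' _ _) (hφ' _ _)

lemma le_symmDeviation (hφ' : ∀ h z, φ h z ∈ Set.Icc (0 : ℝ) 1)
    (σ : Fin n → ℤˣ) (w : Fin n → α × α) (h : ι) :
    |(n : ℝ)⁻¹ * ∑ i, ((σ i : ℤ) : ℝ) * (φ h (w i).1 - φ h (w i).2)| ≤ symmDeviation φ σ w :=
  le_ciSup (bddAbove_signed_average σ (b := fun h i => φ h (w i).1 - φ h (w i).2)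
    fun _ _ => abs_sub_le_one_of_mem_unit (hφ' _ _) (hφ' _ _)) h

lemma symmDeviation_le_add [Nonempty ι] (hφ' : ∀ h z, φ h z ∈ Set.Icc (0 : ℝ) 1)
    (σ : Fin n → ℤˣ) (w : Fin n → α × α) :
    symmDeviation φ σ w
      ≤ (⨆ h, |(n : ℝ)⁻¹ * ∑ i, ((σ i : ℤ) : ℝ) * φ h (w i).1|)
        + ⨆ h, |(n : ℝ)⁻¹ * ∑ i, ((σ i : ℤ) : ℝ) * φ h (w i).2| := by
  have hb : ∀ h z, |φ h z| ≤ 1 := fun h z => by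
    rw [abs_of_nonneg (hφ' h z).1]; exact (hφ' h z).2
  refine ciSup_le fun h => ?_
  simp_rw [mul_sub, Finset.sum_sub_distrib]
  rw [mul_sub]
  exact (abs_sub _ _).trans (add_le_add
    (le_ciSup (bddAbove_signed_average σ (b := fun h i => φ h (w i).1) fun h i => hb _ _) h)
    (le_ciSup (bddAbove_signed_average σ (b := fun h i => φ h (w i).2) fun h i => hb _ _) h))

variable [MeasurableSpace α] {μ : Measure α}

lemma measurable_deviation
    (hmeas : ∀ (m : ℕ) (a : Fin m → ℝ) (b : ℝ),
      Measurable fun z : Fin m → α => ⨆ h, |∑ i, a i * φ h (z i) + b * ∫ w, φ h w ∂μ|) :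
    Measurable fun z : Fin n → α => deviation μ φ z := by
  convert hmeas n (fun _ => (n : ℝ)⁻¹) (-1) using 2
  unfold deviation
  congr 1
  funext h
  rw [← Finset.mul_sum, neg_one_mul, ← sub_eq_add_neg]

/-- A sample of `n` pairs is read as one sample of `2n` points with weights `±σ i / n` and no shift;
this is why signed weights must be allowed in the measurability hypothesis. -/
lemma measurable_symmDeviation
    (hmeas : ∀ (m : ℕ) (a : Fin m → ℝ) (b : ℝ),
      Measurable fun z : Fin m → α => ⨆ h, |∑ i, a i * φ h (z i) + b * ∫ w, φ h w ∂μ|)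
    (σ : Fin n → ℤˣ) : Measurable (symmDeviation φ σ) := by
  have happ : Measurable fun w : Fin n → α × α =>
      (Fin.append (fun i => (w i).1) (fun i => (w i).2) : Fin (n + n) → α) := by
    refine measurable_pi_iff.2 fun i => ?_
    refine Fin.addCases (fun j => ?_) (fun j => ?_) i
    · simp only [Fin.append_left]; fun_prop
    · simp only [Fin.append_right]; fun_prop
  convert (hmeas (n + n) (Fin.append (fun i => (n : ℝ)⁻¹ * ((σ i : ℤ) : ℝ))
    (fun i => -((n : ℝ)⁻¹ * ((σ i : ℤ) : ℝ)))) 0).comp happ using 1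
  funext w
  unfold symmDeviation
  simp only [Function.comp_apply]
  congr 1
  funext h
  rw [Fin.sum_univ_add]
  simp only [Fin.append_left, Fin.append_right, zero_mul, add_zero]
  rw [← Finset.sum_add_distrib, Finset.mul_sum]
  congr 1
  exact Finset.sum_congr rfl fun i _ => by ring

variable [IsProbabilityMeasure μ]

lemma integral_mem_unit (hφ : ∀ h, Measurable (φ h)) (hφ' : ∀ h z, φ h z ∈ Set.Icc (0 : ℝ) 1)
    (h : ι) : ∫ w, φ h w ∂μ ∈ Set.Icc (0 : ℝ) 1 := by
  refine ⟨integral_nonneg fun w => (hφ' h w).1, ?_⟩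
  have hi : Integrable (φ h) μ := integrable_of_abs_le (hφ h) (b := 1) fun z => by
    rw [abs_of_nonneg (hφ' h z).1]; exact (hφ' h z).2
  simpa using integral_mono hi (integrable_const (1 : ℝ)) fun w => (hφ' h w).2

lemma abs_deviation_term_le (hφ : ∀ h, Measurable (φ h))
    (hφ' : ∀ h z, φ h z ∈ Set.Icc (0 : ℝ) 1) (z : Fin n → α) (h : ι) :
    |(n : ℝ)⁻¹ * ∑ i, φ h (z i) - ∫ w, φ h w ∂μ| ≤ 1 :=
  abs_sub_le_one_of_mem_unit (average_mem_unit fun i => hφ' h (z i)) (integral_mem_unit hφ hφ' h)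

lemma le_deviation (hφ : ∀ h, Measurable (φ h)) (hφ' : ∀ h z, φ h z ∈ Set.Icc (0 : ℝ) 1)
    (z : Fin n → α) (h : ι) :
    |(n : ℝ)⁻¹ * ∑ i, φ h (z i) - ∫ w, φ h w ∂μ| ≤ deviation μ φ z :=
  le_ciSup (f := fun h => |(n : ℝ)⁻¹ * ∑ i, φ h (z i) - ∫ w, φ h w ∂μ|)
    ⟨1, by rintro _ ⟨h, rfl⟩; exact abs_deviation_term_le hφ hφ' z h⟩ h

lemma abs_deviation_le [Nonempty ι] (hφ : ∀ h, Measurable (φ h))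
    (hφ' : ∀ h z, φ h z ∈ Set.Icc (0 : ℝ) 1) (z : Fin n → α) : |deviation μ φ z| ≤ 1 := by
  rw [deviation, abs_of_nonneg (Real.iSup_nonneg fun h => abs_nonneg _)]
  exact ciSup_le fun h => abs_deviation_term_le hφ hφ' z h

/-- Symmetrization: replacing the expectation by a second sample. -/
lemma integral_deviation_le_integral_symmDeviation [Nonempty ι] (hn : 1 ≤ n)
    (hφ : ∀ h, Measurable (φ h)) (hφ' : ∀ h z, φ h z ∈ Set.Icc (0 : ℝ) 1)
    (hmeas : ∀ (m : ℕ) (a : Fin m → ℝ) (b : ℝ),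
      Measurable fun z : Fin m → α => ⨆ h, |∑ i, a i * φ h (z i) + b * ∫ w, φ h w ∂μ|) :
    ∫ z, deviation μ φ z ∂(Measure.pi fun _ : Fin n => μ)
      ≤ ∫ w, symmDeviation φ 1 w ∂(Measure.pi fun _ : Fin n => μ.prod μ) := by
  have hn0 : (n : ℝ) ≠ 0 := by exact_mod_cast (Nat.one_le_iff_ne_zero.1 hn)
  set ρ : Measure (Fin n → α) := Measure.pi fun _ => μ
  let e := MeasurableEquiv.arrowProdEquivProdArrow α α (Fin n)
  have he : MeasurePreserving e (Measure.pi fun _ => μ.prod μ) (ρ.prod ρ) :=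
    measurePreserving_arrowProdEquivProdArrow α α (Fin n) (fun _ => μ) (fun _ => μ)
  let Ψ : (Fin n → α) × (Fin n → α) → ℝ := fun p => symmDeviation φ 1 fun i => (p.1 i, p.2 i)
  have hΨ : Measurable Ψ := (measurable_symmDeviation hmeas 1).comp (by fun_prop)
  have hΨb : ∀ p, |Ψ p| ≤ 1 := fun p => abs_symmDeviation_le hφ' 1 _
  have hΨint : Integrable Ψ (ρ.prod ρ) := integrable_of_abs_le hΨ hΨb
  have hφint : ∀ h, Integrable (φ h) μ := fun h => integrable_of_abs_le (hφ h) (b := 1) fun z => by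
    rw [abs_of_nonneg (hφ' h z).1]; exact (hφ' h z).2
  -- For each `h` the deviation is a mean over a ghost sample `z'`, and a supremum of means is at
  -- most the mean of the supremum.
  have hstep : ∀ z, deviation μ φ z ≤ ∫ z', Ψ (z, z') ∂ρ := fun z => by
    refine ciSup_le fun h => ?_
    have hci : ∀ i : Fin n, Integrable (fun z' : Fin n → α => φ h (z' i)) ρ := fun i =>
      integrable_comp_eval (hφint h)
    have hdi : ∀ i : Fin n, Integrable (fun z' : Fin n → α => φ h (z i) - φ h (z' i)) ρ :=
      fun i => (integrable_const _).sub (hci i)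
    have hmean : (n : ℝ)⁻¹ * ∑ i, φ h (z i) - ∫ w, φ h w ∂μ
        = ∫ z', (n : ℝ)⁻¹ * ∑ i, (((1 : Fin n → ℤˣ) i : ℤ) : ℝ) * (φ h (z i) - φ h (z' i)) ∂ρ := by
      simp only [Pi.one_apply, Units.val_one, Int.cast_one, one_mul]
      rw [integral_const_mul, integral_finsetSum _ fun i _ => hdi i]
      have : ∀ i : Fin n, ∫ z', (φ h (z i) - φ h (z' i)) ∂ρ = φ h (z i) - ∫ w, φ h w ∂μ :=
        fun i => by
          rw [integral_sub (integrable_const _) (hci i),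
            integral_comp_eval (hφint h).aestronglyMeasurable]
          simp
      simp_rw [this]
      rw [Finset.sum_sub_distrib, mul_sub]
      simp [hn0]
    rw [hmean]
    refine (abs_integral_le_integral_abs).trans ?_
    refine integral_mono_of_nonneg (Filter.Eventually.of_forall fun _ => abs_nonneg _)
      (integrable_of_abs_le (hΨ.comp measurable_prodMk_left) fun z' => hΨb _)
      (Filter.Eventually.of_forall fun z' => ?_)
    exact le_symmDeviation hφ' 1 (fun i => (z i, z' i)) h
  calc ∫ z, deviation μ φ z ∂ρ ≤ ∫ z, ∫ z', Ψ (z, z') ∂ρ ∂ρ :=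
        integral_mono (integrable_of_abs_le (measurable_deviation hmeas)
          (abs_deviation_le hφ hφ')) hΨint.integral_prod_left hstep
    _ = ∫ p, Ψ p ∂(ρ.prod ρ) := (integral_prod _ hΨint).symm
    _ = ∫ w, symmDeviation φ 1 w ∂(Measure.pi fun _ : Fin n => μ.prod μ) := by
        rw [← he.integral_comp e.measurableEmbedding]
        rfl

/-- Swapping the two points of some of the pairs does not change the expected deviation. -/
lemma integral_symmDeviation_eq
    (hmeas : ∀ (m : ℕ) (a : Fin m → ℝ) (b : ℝ),
      Measurable fun z : Fin m → α => ⨆ h, |∑ i, a i * φ h (z i) + b * ∫ w, φ h w ∂μ|)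
    (σ : Fin n → ℤˣ) :
    ∫ w, symmDeviation φ 1 w ∂(Measure.pi fun _ : Fin n => μ.prod μ)
      = ∫ w, symmDeviation φ σ w ∂(Measure.pi fun _ : Fin n => μ.prod μ) := by
  let s : Fin n → α × α → α × α := fun i => if σ i = 1 then id else Prod.swap
  have hs : MeasurePreserving (fun (w : Fin n → α × α) i => s i (w i))
      (Measure.pi fun _ => μ.prod μ) (Measure.pi fun _ => μ.prod μ) :=
    measurePreserving_pi _ _ fun i => by
      simp only [s]
      split_ifs
      · exact MeasurePreserving.id _
      · exact Measure.measurePreserving_swap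
  conv_lhs => rw [← hs.map_eq]
  rw [integral_map hs.aemeasurable (measurable_symmDeviation hmeas 1).aestronglyMeasurable]
  refine integral_congr_ae (Filter.Eventually.of_forall fun w => ?_)
  unfold symmDeviation
  simp only
  congr 1
  funext h
  congr 2
  refine Finset.sum_congr rfl fun i _ => ?_
  rcases Int.units_eq_one_or (σ i) with hi | hi
  · simp [s, hi]
  · have : ¬ ((-1 : ℤˣ) = 1) := by decide
    simp [s, hi, this]

/-- The expected uniform deviation is at most twice the worst-case Rademacher average. -/
theorem integral_deviation_le [Nonempty ι] (hn : 1 ≤ n)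
    (hφ : ∀ h, Measurable (φ h)) (hφ' : ∀ h z, φ h z ∈ Set.Icc (0 : ℝ) 1)
    (hmeas : ∀ (m : ℕ) (a : Fin m → ℝ) (b : ℝ),
      Measurable fun z : Fin m → α => ⨆ h, |∑ i, a i * φ h (z i) + b * ∫ w, φ h w ∂μ|)
    {r : ℝ} (hr : ∀ z : Fin n → α, (2 ^ n : ℝ)⁻¹ * ∑ σ : Fin n → ℤˣ,
      ⨆ h, |(n : ℝ)⁻¹ * ∑ i, ((σ i : ℤ) : ℝ) * φ h (z i)| ≤ r) :
    ∫ z, deviation μ φ z ∂(Measure.pi fun _ : Fin n => μ) ≤ 2 * r := by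
  set ρ : Measure (Fin n → α × α) := Measure.pi fun _ => μ.prod μ
  have hint : ∀ σ : Fin n → ℤˣ, Integrable (symmDeviation φ σ) ρ := fun σ =>
    integrable_of_abs_le (measurable_symmDeviation hmeas σ) (abs_symmDeviation_le hφ' σ)
  calc ∫ z, deviation μ φ z ∂(Measure.pi fun _ : Fin n => μ)
      ≤ ∫ w, symmDeviation φ 1 w ∂ρ :=
        integral_deviation_le_integral_symmDeviation hn hφ hφ' hmeas
    -- The swapping identity holds for every `σ`, hence on average over `σ`.
    _ = (2 ^ n : ℝ)⁻¹ * ∑ σ : Fin n → ℤˣ, ∫ w, symmDeviation φ σ w ∂ρ := by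
        simp_rw [ρ, ← integral_symmDeviation_eq hmeas]
        rw [Finset.sum_const, Finset.card_univ, card_signs]
        simp
    _ = ∫ w, (2 ^ n : ℝ)⁻¹ * ∑ σ : Fin n → ℤˣ, symmDeviation φ σ w ∂ρ := by
        rw [integral_const_mul, integral_finsetSum _ fun σ _ => hint σ]
    _ ≤ ∫ _, 2 * r ∂ρ := by
        refine integral_mono ((integrable_finsetSum _ fun σ _ => hint σ).const_mul _)
          (integrable_const _) fun w => ?_
        have h := mul_le_mul_of_nonneg_left
          (Finset.sum_le_sum fun σ (_ : σ ∈ Finset.univ) => symmDeviation_le_add hφ' σ w)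
          (by positivity : (0 : ℝ) ≤ (2 ^ n : ℝ)⁻¹)
        rw [Finset.sum_add_distrib, mul_add] at h
        refine h.trans ?_
        linarith [hr fun i => (w i).1, hr fun i => (w i).2]
    _ = 2 * r := by simp

/-- Changing one point moves every empirical mean by at most `1/n`, uniformly in `h`, and suprema
inherit this; it is the hypothesis of McDiarmid's inequality. -/
lemma abs_deviation_update_sub_le [Nonempty ι]
    (hφ : ∀ h, Measurable (φ h)) (hφ' : ∀ h z, φ h z ∈ Set.Icc (0 : ℝ) 1)
    (z : Fin n → α) (i : Fin n) (y : α) :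
    |deviation μ φ (Function.update z i y) - deviation μ φ z| ≤ (n : ℝ)⁻¹ := by
  have hclose : ∀ (z z' : Fin n → α), (∀ k, k ≠ i → z k = z' k) →
      deviation μ φ z - deviation μ φ z' ≤ (n : ℝ)⁻¹ := fun z z' hzz => by
    rw [sub_le_iff_le_add']
    refine ciSup_le fun h => ?_
    have hsum : ∑ k, φ h (z k) - ∑ k, φ h (z' k) = φ h (z i) - φ h (z' i) := by
      rw [← Finset.sum_sub_distrib, Finset.sum_eq_single i]
      · intro k _ hk; rw [hzz k hk, sub_self]
      · simp
    have hsplit : (n : ℝ)⁻¹ * ∑ k, φ h (z k) - ∫ w, φ h w ∂μ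
        = ((n : ℝ)⁻¹ * ∑ k, φ h (z' k) - ∫ w, φ h w ∂μ)
          + (n : ℝ)⁻¹ * (φ h (z i) - φ h (z' i)) := by
      rw [← hsum]; ring
    rw [hsplit]
    refine (abs_add_le _ _).trans (add_le_add (le_deviation hφ hφ' z' h) ?_)
    rw [abs_mul, abs_inv, Nat.abs_cast]
    exact mul_le_of_le_one_right (by positivity)
      (abs_sub_le_one_of_mem_unit (hφ' _ _) (hφ' _ _))
  refine abs_le.2 ⟨?_, hclose _ _ fun k hk => Function.update_of_ne hk _ _⟩
  linarith [hclose z (Function.update z i y) fun k hk => (Function.update_of_ne hk _ _).symm]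

/-- Uniform convergence: with probability at least `1 - exp (-2 n t²)`, the uniform deviation
exceeds twice the worst-case Rademacher average by less than `t`. -/
theorem measure_deviation_ge_le [Nonempty ι] (hn : 1 ≤ n)
    (hφ : ∀ h, Measurable (φ h)) (hφ' : ∀ h z, φ h z ∈ Set.Icc (0 : ℝ) 1)
    (hmeas : ∀ (m : ℕ) (a : Fin m → ℝ) (b : ℝ),
      Measurable fun z : Fin m → α => ⨆ h, |∑ i, a i * φ h (z i) + b * ∫ w, φ h w ∂μ|)
    {r : ℝ} (hr : ∀ z : Fin n → α, (2 ^ n : ℝ)⁻¹ * ∑ σ : Fin n → ℤˣ,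
      ⨆ h, |(n : ℝ)⁻¹ * ∑ i, ((σ i : ℤ) : ℝ) * φ h (z i)| ≤ r) {t : ℝ} (ht : 0 ≤ t) :
    (Measure.pi fun _ : Fin n => μ).real {z | 2 * r + t ≤ deviation μ φ z}
      ≤ Real.exp (-2 * n * t ^ 2) := by
  refine le_trans (measureReal_mono fun z hz => ?_)
    (bounded_differences_inequality μ hn _ (measurable_deviation hmeas)
      (abs_deviation_le hφ hφ') (abs_deviation_update_sub_le hφ hφ') ht)
  have h := integral_deviation_le hn hφ hφ' hmeas hr
  simp only [Set.mem_ofPred_eq] at hz ⊢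
  linarith

end UniformDeviation

/-! ### Randomized classifiers as convex combinations. -/

section Mixtures

variable {𝒳 : Type*} {H : Set (𝒳 → Fin 2)}

lemma summable_weights (Q : PMF H) : Summable fun h => (Q h).toReal :=
  ENNReal.summable_toReal Q.tsum_coe_ne_top

lemma tsum_weights (Q : PMF H) : ∑' h, (Q h).toReal = 1 := by
  rw [← ENNReal.tsum_toReal_eq fun h => Q.apply_ne_top h, Q.tsum_coe, ENNReal.toReal_one]

lemma summable_mix (Q : PMF H) {f : (𝒳 → Fin 2) → ℝ} (hf : ∀ h ∈ H, f h ∈ Set.Icc (0 : ℝ) 1) :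
    Summable fun h : H => (Q h).toReal * f h.1 :=
  Summable.of_nonneg_of_le (fun h => mul_nonneg ENNReal.toReal_nonneg (hf h h.2).1)
    (fun h => mul_le_of_le_one_right ENNReal.toReal_nonneg (hf h h.2).2) (summable_weights Q)

lemma mix_le_add (Q : PMF H) {f g : (𝒳 → Fin 2) → ℝ} {t : ℝ}
    (hf : ∀ h ∈ H, f h ∈ Set.Icc (0 : ℝ) 1) (hg : ∀ h ∈ H, g h ∈ Set.Icc (0 : ℝ) 1)
    (hfg : ∀ h ∈ H, f h ≤ g h + t) : mix Q f ≤ mix Q g + t := by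
  have ht : ∑' h, (Q h).toReal * t = t := by rw [tsum_mul_right, tsum_weights, one_mul]
  unfold mix
  conv_rhs => rw [← ht]
  rw [← (summable_mix Q hg).tsum_add ((summable_weights Q).mul_right t)]
  refine (summable_mix Q hf).tsum_le_tsum (fun h => ?_)
    ((summable_mix Q hg).add ((summable_weights Q).mul_right t))
  rw [← mul_add]
  exact mul_le_mul_of_nonneg_left (hfg h h.2) ENNReal.toReal_nonneg

/-- Weights sum to one, so passing from `H` to its mixtures adds no complexity term. -/
lemma abs_mix_sub_le (Q : PMF H) {f g : (𝒳 → Fin 2) → ℝ} {t : ℝ}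
    (hf : ∀ h ∈ H, f h ∈ Set.Icc (0 : ℝ) 1) (hg : ∀ h ∈ H, g h ∈ Set.Icc (0 : ℝ) 1)
    (hfg : ∀ h ∈ H, |f h - g h| ≤ t) : |mix Q f - mix Q g| ≤ t := by
  have h1 := mix_le_add Q hf hg fun h hh => by linarith [(abs_le.1 (hfg h hh)).2]
  have h2 := mix_le_add Q hg hf fun h hh => by linarith [(abs_le.1 (hfg h hh)).1]
  exact abs_le.2 ⟨by linarith, by linarith⟩

lemma mix_mem_unit (Q : PMF H) {f : (𝒳 → Fin 2) → ℝ} (hf : ∀ h ∈ H, f h ∈ Set.Icc (0 : ℝ) 1) :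
    mix Q f ∈ Set.Icc (0 : ℝ) 1 := by
  refine ⟨tsum_nonneg fun h => mul_nonneg ENNReal.toReal_nonneg (hf h h.2).1, ?_⟩
  rw [← tsum_weights Q]
  exact (summable_mix Q hf).tsum_le_tsum
    (fun h => mul_le_of_le_one_right ENNReal.toReal_nonneg (hf h h.2).2) (summable_weights Q)

/-- The difference of two linear combinations of mixed moments. -/
lemma sum_mul_mix_le_add {J : Type*} [Fintype J] {f g : J → (𝒳 → Fin 2) → ℝ} {Q : PMF H} {t : J → ℝ}
    (hf : ∀ j, ∀ h ∈ H, f j h ∈ Set.Icc (0 : ℝ) 1) (hg : ∀ j, ∀ h ∈ H, g j h ∈ Set.Icc (0 : ℝ) 1)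
    (hfg : ∀ j, ∀ h ∈ H, |f j h - g j h| ≤ t j) (a : J → ℝ) :
    ∑ j, a j * mix Q (f j) ≤ ∑ j, a j * mix Q (g j) + ∑ j, |a j| * t j := by
  rw [← Finset.sum_add_distrib]
  refine Finset.sum_le_sum fun j _ => ?_
  have h := (le_abs_self (a j * (mix Q (f j) - mix Q (g j)))).trans (le_of_eq (abs_mul _ _))
  have h' := mul_le_mul_of_nonneg_left (abs_mix_sub_le Q (hf j) (hg j) (hfg j)) (abs_nonneg (a j))
  linarith [mul_sub (a j) (mix Q (f j)) (mix Q (g j))]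

end Mixtures

/-! ### Errors and moments lie in the unit interval. -/

section Ranges

lemma empErr_mem_unit {𝒳 𝒜 : Type*} {n : ℕ} (S : Fin n → Point 𝒳 𝒜) (h : 𝒳 → Fin 2) :
    empErr S h ∈ Set.Icc (0 : ℝ) 1 :=
  average_mem_unit fun i => by split_ifs <;> simp

variable {𝒳 𝒜 J K : Type*} [MeasurableSpace 𝒳] [MeasurableSpace 𝒜] {n : ℕ}

lemma err_mem_unit (D : Measure (Point 𝒳 𝒜)) [IsProbabilityMeasure D] (h : 𝒳 → Fin 2) :
    err D h ∈ Set.Icc (0 : ℝ) 1 :=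
  ⟨measureReal_nonneg, measureReal_le_one⟩

lemma empMoment_mem_unit (F : Constraints 𝒳 𝒜 J K) (S : Fin n → Point 𝒳 𝒜) (j : J)
    (h : 𝒳 → Fin 2) : empMoment F S j h ∈ Set.Icc (0 : ℝ) 1 := by
  refine ⟨mul_nonneg (by positivity) (Finset.sum_nonneg fun i _ => (F.g_mem _ _ _).1), ?_⟩
  refine inv_mul_le_one_of_le₀ ?_ (by positivity)
  exact (Finset.sum_le_sum fun i _ => (F.g_mem _ _ _).2).trans (by simp [count])

lemma measurable_comp_classifier {f : Point 𝒳 𝒜 → Fin 2 → ℝ} (hf : Measurable (Function.uncurry f))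
    {h : 𝒳 → Fin 2} (hh : Measurable h) : Measurable fun z : Point 𝒳 𝒜 => f z (h z.1) :=
  hf.comp (measurable_id.prodMk (hh.comp measurable_fst))

lemma moment_mem_unit (F : Constraints 𝒳 𝒜 J K) (D : Measure (Point 𝒳 𝒜))
    [IsProbabilityMeasure D] (j : J) {h : 𝒳 → Fin 2} (hh : Measurable h) :
    moment F D j h ∈ Set.Icc (0 : ℝ) 1 := by
  -- Conditioning on a null event gives the zero measure, so the moment is then 0.
  by_cases h0 : D (F.E j) = 0
  · have : ProbabilityTheory.cond D (F.E j) = 0 := cond_eq_zero_of_meas_eq_zero h0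
    simp [moment, this]
  · have := cond_isProbabilityMeasure h0
    exact integral_mem_unit (ι := Unit) (φ := fun _ z => F.g j z (h z.1))
      (fun _ => measurable_comp_classifier (F.measurable_g j) hh) (fun _ _ => F.g_mem _ _ _) ()

end Ranges

/-! ### Deterministic consequences of an approximate saddle point. -/

section Saddle

variable {𝒳 𝒜 J K : Type*} [MeasurableSpace 𝒳] [MeasurableSpace 𝒜] [Fintype J]
  {H : Set (𝒳 → Fin 2)} {n : ℕ} {F : Constraints 𝒳 𝒜 J K} {S : Fin n → Point 𝒳 𝒜}
  {chat : K → ℝ} {B ν : ℝ} {Q Q' : PMF H} {l : K → ℝ}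

variable {D : Measure (Point 𝒳 𝒜)} [IsProbabilityMeasure D] {Qstar : PMF H} {C' α t u : ℝ}

/-- The slack has the form of the moment deviation with the larger constant `C'`, so relaxation
keeps the true optimum empirically feasible. -/
lemma empGammaQ_le_of_isOptimal (hH : ∀ h ∈ H, Measurable h)
    (hQstar : IsOptimal F D Qstar) (ht : t ≤ C')
    (hmom : ∀ j, ∀ h ∈ H, |empMoment F S j h - moment F D j h| ≤ t * (count F S j : ℝ) ^ (-α))
    (k : K) : empGammaQ F S Qstar k ≤ F.c k + slack F S C' α k := by
  refine (sum_mul_mix_le_add (fun j h _ => empMoment_mem_unit F S j h)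
    (fun j h hh => moment_mem_unit F D j (hH h hh)) hmom (F.M k)).trans ?_
  refine add_le_add (hQstar.1 k) ?_
  rw [slack, Finset.mul_sum]
  refine Finset.sum_le_sum fun j _ => ?_
  have h1 : 0 ≤ |F.M k j| * (count F S j : ℝ) ^ (-α) := by positivity
  nlinarith

/-- Constraint violations of any randomized classifier are at most those by the `ℓ₁` norm of the
row of the constraint matrix, provided the constraints are feasible. -/
lemma gammaQ_le_of_feasible (hH : ∀ h ∈ H, Measurable h)
    (hQstar : IsOptimal F D Qstar) (Q : PMF H) (k : K) {b : J → ℝ} (hb : ∀ j, 1 ≤ b j) :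
    gammaQ F D Q k ≤ F.c k + ∑ j, |F.M k j| * b j := by
  refine le_trans ?_ (add_le_add_left (hQstar.1 k) _)
  unfold gammaQ
  rw [← Finset.sum_add_distrib]
  refine Finset.sum_le_sum fun j _ => ?_
  have hu : ∀ R : PMF H, mix R (moment F D j) ∈ Set.Icc (0 : ℝ) 1 := fun R =>
    mix_mem_unit R fun h hh => moment_mem_unit F D j (hH h hh)
  have h1 := (le_abs_self (F.M k j * (mix Q (moment F D j) - mix Qstar (moment F D j)))).trans
    (le_of_eq (abs_mul _ _))
  have h2 := mul_le_mul_of_nonneg_left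
    ((abs_sub_le_one_of_mem_unit (hu Q) (hu Qstar)).trans (hb j)) (abs_nonneg (F.M k j))
  linarith [mul_sub (F.M k j) (mix Q (moment F D j)) (mix Qstar (moment F D j))]

variable [Fintype K]

lemma IsApproxSaddle.nonneg (hs : IsApproxSaddle F S chat B ν Q l) : 0 ≤ ν := by
  linarith [hs.2.1 Q]

lemma IsApproxSaddle.lagrangian_le (hs : IsApproxSaddle F S chat B ν Q l)
    (hQ' : ∀ k, empGammaQ F S Q' k ≤ chat k) :
    lagrangian F S chat Q l ≤ empErrQ S Q' + ν := by
  refine (hs.2.1 Q').trans (add_le_add_left ?_ ν)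
  have : ∑ k, l k * (empGammaQ F S Q' k - chat k) ≤ 0 := Finset.sum_nonpos fun k _ =>
    mul_nonpos_of_nonneg_of_nonpos (hs.1.1 k) (sub_nonpos.2 (hQ' k))
  unfold lagrangian
  linarith

lemma IsApproxSaddle.empErrQ_le (hs : IsApproxSaddle F S chat B ν Q l) (hB : 0 < B)
    (hQ' : ∀ k, empGammaQ F S Q' k ≤ chat k) : empErrQ S Q ≤ empErrQ S Q' + 2 * ν := by
  -- The zero multiplier leaves only the error; each saddle inequality contributes one `ν`.
  have h0 := hs.2.2 0 ⟨fun _ => le_rfl, by simpa using hB.le⟩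
  have h1 := hs.lagrangian_le hQ'
  simp only [lagrangian, Pi.zero_apply, zero_mul, Finset.sum_const_zero, add_zero] at h0 h1
  linarith

lemma IsApproxSaddle.empGammaQ_le (hs : IsApproxSaddle F S chat B ν Q l) (hB : 0 < B)
    (hQ' : ∀ k, empGammaQ F S Q' k ≤ chat k) (k : K) :
    empGammaQ F S Q k ≤ chat k + (1 + 2 * ν) / B := by
  classical
  -- Putting the whole budget `B` on constraint `k` charges its violation `B` times, while the gain
  -- in error is at most 1.
  have h0 := hs.2.2 (Pi.single k B) ⟨fun i => by
      by_cases hi : i = k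
      · subst hi; simpa using hB.le
      · simp [hi], by
      rw [Finset.sum_eq_single k (fun i _ hi => by simp [hi]) (by simp)]
      simp [abs_of_pos hB]⟩
  have h1 := hs.lagrangian_le hQ'
  have hsum : ∑ i, (Pi.single k B : K → ℝ) i * (empGammaQ F S Q i - chat i)
      = B * (empGammaQ F S Q k - chat k) := by
    rw [Finset.sum_eq_single k (fun i _ hi => by simp [hi]) (by simp)]
    simp
  have hQ0 : 0 ≤ empErrQ S Q := (mix_mem_unit Q fun h _ => empErr_mem_unit S h).1
  have hQ1 : empErrQ S Q' ≤ 1 := (mix_mem_unit Q' fun h _ => empErr_mem_unit S h).2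
  rw [lagrangian, hsum] at h0
  have : empGammaQ F S Q k - chat k ≤ (1 + 2 * ν) / B := by
    rw [le_div_iff₀ hB]
    linarith
  linarith

lemma errQ_le_of_isApproxSaddle (hH : ∀ h ∈ H, Measurable h)
    (hQstar : IsOptimal F D Qstar) (hB : 0 < B) (ht : t ≤ C')
    (herr : ∀ h ∈ H, |empErr S h - err D h| ≤ u)
    (hmom : ∀ j, ∀ h ∈ H, |empMoment F S j h - moment F D j h| ≤ t * (count F S j : ℝ) ^ (-α))
    (hs : IsApproxSaddle F S (fun k => F.c k + slack F S C' α k) B ν Q l) :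
    errQ D Q ≤ errQ D Qstar + 2 * ν + 2 * u := by
  have h1 := hs.empErrQ_le hB (empGammaQ_le_of_isOptimal hH hQstar ht hmom)
  have h2 : ∀ R : PMF H, |empErrQ S R - errQ D R| ≤ u := fun R =>
    abs_mix_sub_le R (fun h _ => empErr_mem_unit S h) (fun h _ => err_mem_unit D h) herr
  linarith [(abs_le.1 (h2 Q)).1, (abs_le.1 (h2 Qstar)).2]

/-- Of the factor `2 * C'`, one half is the slack and the other the deviation between empirical and
true moments. -/
lemma gammaQ_le_of_isApproxSaddle (hH : ∀ h ∈ H, Measurable h)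
    (hQstar : IsOptimal F D Qstar) (hB : 0 < B) (ht : t ≤ C')
    (hmom : ∀ j, ∀ h ∈ H, |empMoment F S j h - moment F D j h| ≤ t * (count F S j : ℝ) ^ (-α))
    (hs : IsApproxSaddle F S (fun k => F.c k + slack F S C' α k) B ν Q l) (k : K) :
    gammaQ F D Q k ≤ F.c k + (1 + 2 * ν) / B
      + ∑ j, |F.M k j| * (2 * C' * (count F S j : ℝ) ^ (-α)) := by
  have h1 := hs.empGammaQ_le hB (empGammaQ_le_of_isOptimal hH hQstar ht hmom) k
  have h2 : gammaQ F D Q k ≤ empGammaQ F S Q k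
      + ∑ j, |F.M k j| * (C' * (count F S j : ℝ) ^ (-α)) := by
    refine sum_mul_mix_le_add (fun j h hh => moment_mem_unit F D j (hH h hh))
      (fun j h _ => empMoment_mem_unit F S j h) (fun j h hh => ?_) (F.M k)
    rw [abs_sub_comm]
    exact (hmom j h hh).trans (by gcongr)
  have h3 : ∑ j, |F.M k j| * (2 * C' * (count F S j : ℝ) ^ (-α))
      = slack F S C' α k + ∑ j, |F.M k j| * (C' * (count F S j : ℝ) ^ (-α)) := by
    rw [slack, Finset.mul_sum, ← Finset.sum_add_distrib]
    exact Finset.sum_congr rfl fun j _ => by ring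
  rw [h3]
  linarith

end Saddle

/-! ### Uniform convergence of errors, conditional moments and counts. -/

section UniformConvergence

variable {𝒳 𝒜 J K : Type*} [MeasurableSpace 𝒳] [MeasurableSpace 𝒜] {H : Set (𝒳 → Fin 2)}

lemma inv_sqrt_le_rpow {n : ℕ} (hn : 1 ≤ n) {α : ℝ} (hα : α ≤ 1 / 2) :
    (√n)⁻¹ ≤ (n : ℝ) ^ (-α) := by
  rw [Real.sqrt_eq_rpow, ← Real.rpow_neg n.cast_nonneg]
  exact Real.rpow_le_rpow_of_exponent_le (by exact_mod_cast hn) (by linarith)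

/-- The uniform deviation over a class of Rademacher complexity at most `C n ^ (-α)`. -/
theorem measure_deviation_classifier_le [Nonempty H] (hH : ∀ h ∈ H, Measurable h)
    (μ : Measure (Point 𝒳 𝒜)) [IsProbabilityMeasure μ] {f : Point 𝒳 𝒜 → Fin 2 → ℝ}
    (hf : Measurable (Function.uncurry f)) (hf' : ∀ z y, f z y ∈ Set.Icc (0 : ℝ) 1)
    (hmeas : ∀ (m : ℕ) (a : Fin m → ℝ) (b : ℝ), Measurable fun z : Fin m → Point 𝒳 𝒜 =>
      ⨆ h : H, |∑ i, a i * f (z i) (h.1 (z i).1) + b * ∫ w, f w (h.1 w.1) ∂μ|)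
    {n : ℕ} (hn : 1 ≤ n) {C α δ : ℝ} (hα : α ≤ 1 / 2) (hδ : 0 < δ) (hδ1 : δ ≤ 4)
    (hR : rademacher H n ≤ C * (n : ℝ) ^ (-α)) :
    (Measure.pi fun _ : Fin n => μ).real {z | (2 * C + 2 + √(Real.log (4 / δ) / 2)) * (n : ℝ) ^ (-α)
      ≤ deviation μ (fun (h : H) z => f z (h.1 z.1)) z} ≤ δ / 4 := by
  set s := √(Real.log (4 / δ) / 2) with hs
  have hn0 : (0 : ℝ) < n := by exact_mod_cast hn
  have hlog : 0 ≤ Real.log (4 / δ) := Real.log_nonneg ((one_le_div hδ).2 hδ1)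
  have hpow := inv_sqrt_le_rpow hn hα
  have hs0 : 0 ≤ s := Real.sqrt_nonneg _
  -- The choice `t = s / √n` makes `exp (-2 n t²)` equal to `δ / 4`; the Rademacher term is `2 (C n
  -- ^ (-α) + 1 / √n)`.
  refine (measureReal_mono fun z hz => ?_).trans
    ((measure_deviation_ge_le hn (fun h => measurable_comp_classifier hf (hH _ h.2))
      (fun h z => hf' _ _) hmeas (rademacher_comp_le hn hf') (t := s * (√n)⁻¹)
      (by positivity)).trans (le_of_eq ?_))
  · simp only [Set.mem_ofPred_eq] at hz ⊢
    refine le_trans ?_ hz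
    nlinarith
  · have h1 : -2 * n * (s * (√n)⁻¹) ^ 2 = -Real.log (4 / δ) := by
      rw [mul_pow, inv_pow, Real.sq_sqrt hn0.le, hs, Real.sq_sqrt (by positivity)]
      field_simp
    rw [h1, Real.exp_neg, Real.exp_log (by positivity), inv_div]

/-- The loss as a function of the data point and the prediction. -/
def errLoss (z : Point 𝒳 𝒜) (y : Fin 2) : ℝ := if y ≠ z.2.2 then 1 else 0

lemma measurable_errLoss : Measurable (Function.uncurry (errLoss (𝒳 := 𝒳) (𝒜 := 𝒜))) := by
  have h : Measurable fun p : Fin 2 × Fin 2 => if p.1 ≠ p.2 then (1 : ℝ) else 0 :=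
    measurable_of_countable _
  exact h.comp (measurable_snd.prodMk measurable_fst.snd.snd)

lemma errLoss_mem_unit {𝒳 𝒜 : Type*} (z : Point 𝒳 𝒜) (y : Fin 2) :
    errLoss z y ∈ Set.Icc (0 : ℝ) 1 := by
  unfold errLoss
  split_ifs <;> simp

lemma integral_errLoss (D : Measure (Point 𝒳 𝒜)) {h : 𝒳 → Fin 2} (hh : Measurable h) :
    ∫ z, errLoss z (h z.1) ∂D = err D h := by
  have hset : MeasurableSet {z : Point 𝒳 𝒜 | h z.1 ≠ z.2.2} :=
    (measurableSet_eq_fun (hh.comp measurable_fst) measurable_snd.snd).compl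
  have : (fun z : Point 𝒳 𝒜 => errLoss z (h z.1))
      = {z : Point 𝒳 𝒜 | h z.1 ≠ z.2.2}.indicator fun _ => (1 : ℝ) := by
    funext z
    simp only [errLoss, Set.indicator_apply, Set.mem_ofPred_eq]
  rw [this, integral_indicator_const _ hset]
  simp [err]

variable {D : Measure (Point 𝒳 𝒜)}

/-- Uniform convergence of the empirical error. -/
theorem exists_uniform_err_event [IsProbabilityMeasure D] [Nonempty H] (hH : ∀ h ∈ H, Measurable h)
    (hsup : SupMeasurable H D) {n : ℕ} (hn : 1 ≤ n) {C α δ : ℝ} (hα : α ≤ 1 / 2) (hδ : 0 < δ)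
    (hδ1 : δ ≤ 4) (hR : rademacher H n ≤ C * (n : ℝ) ^ (-α)) :
    ∃ A : Set (Fin n → Point 𝒳 𝒜), MeasurableSet A ∧
      (Measure.pi fun _ : Fin n => D).real A ≤ δ / 4 ∧
      ∀ S ∉ A, ∀ h ∈ H, |empErr S h - err D h|
        ≤ (2 * C + 2 + √(Real.log (4 / δ) / 2)) * (n : ℝ) ^ (-α) := by
  have hmeas := hsup errLoss measurable_errLoss errLoss_mem_unit
  refine ⟨{z | (2 * C + 2 + √(Real.log (4 / δ) / 2)) * (n : ℝ) ^ (-α)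
      ≤ deviation D (fun (h : H) z => errLoss z (h.1 z.1)) z},
    measurableSet_le measurable_const (measurable_deviation hmeas),
    measure_deviation_classifier_le hH D measurable_errLoss errLoss_mem_unit hmeas hn hα hδ hδ1 hR,
    fun S hS h hh => ?_⟩
  refine le_trans ?_ (not_le.1 hS).le
  have := le_deviation (μ := D) (φ := fun (h : H) z => errLoss z (h.1 z.1))
    (fun h => measurable_comp_classifier measurable_errLoss (hH _ h.2))
    (fun h z => errLoss_mem_unit _ _) S ⟨h, hh⟩
  rw [integral_errLoss D (hH h hh)] at this
  exact this

open Classical in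
/-- The moment function `g_j`, set to zero outside `E_j`. -/
def momentLoss (F : Constraints 𝒳 𝒜 J K) (j : J) (z : Point 𝒳 𝒜) (y : Fin 2) : ℝ :=
  if z ∈ F.E j then F.g j z y else 0

lemma measurable_momentLoss (F : Constraints 𝒳 𝒜 J K) (j : J) :
    Measurable (Function.uncurry (momentLoss F j)) :=
  Measurable.ite (measurable_fst (F.measurableSet_E j)) (F.measurable_g j) measurable_const

lemma momentLoss_mem_unit (F : Constraints 𝒳 𝒜 J K) (j : J) (z : Point 𝒳 𝒜) (y : Fin 2) :
    momentLoss F j z y ∈ Set.Icc (0 : ℝ) 1 := by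
  unfold momentLoss
  split_ifs
  exacts [F.g_mem j z y, by simp]

lemma integral_cond_momentLoss (F : Constraints 𝒳 𝒜 J K) (j : J) (h : 𝒳 → Fin 2) :
    ∫ z, momentLoss F j z (h z.1) ∂(ProbabilityTheory.cond D (F.E j)) = moment F D j h :=
  integral_congr_ae <| (ae_cond_mem (F.measurableSet_E j)).mono fun z hz => by
    simp only [momentLoss, if_pos hz]

/-- Truncating outside `E_j` makes the conditional mean a multiple of a mean under `D`; for a null
event both sides are 0. -/
lemma moment_eq_inv_mul_integral (F : Constraints 𝒳 𝒜 J K) (j : J) (h : 𝒳 → Fin 2) :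
    moment F D j h = (D.real (F.E j))⁻¹ * ∫ z, momentLoss F j z (h z.1) ∂D := by
  rw [← integral_cond_momentLoss, ProbabilityTheory.cond, integral_smul_measure,
    setIntegral_eq_integral_of_forall_compl_eq_zero
      (f := fun z => momentLoss F j z (h z.1)) fun z hz => if_neg hz, smul_eq_mul,
    ENNReal.toReal_inv]
  rfl

/-- The free shift coefficient in `SupMeasurable` absorbs the factor `1 / D(E_j)`, so measurability
under `D` covers the conditional law. -/
lemma measurable_iSup_momentLoss (hsup : SupMeasurable H D) (F : Constraints 𝒳 𝒜 J K) (j : J)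
    (m : ℕ) (a : Fin m → ℝ) (b : ℝ) :
    Measurable fun z : Fin m → Point 𝒳 𝒜 => ⨆ h : H, |∑ i, a i * momentLoss F j (z i) (h.1 (z i).1)
      + b * ∫ w, momentLoss F j w (h.1 w.1) ∂(ProbabilityTheory.cond D (F.E j))| := by
  simp_rw [integral_cond_momentLoss, moment_eq_inv_mul_integral, ← mul_assoc]
  exact hsup _ (measurable_momentLoss F j) (momentLoss_mem_unit F j) m a _

variable [IsProbabilityMeasure D]

lemma mem_idx {n : ℕ} (F : Constraints 𝒳 𝒜 J K) (S : Fin n → Point 𝒳 𝒜) (j : J) (i : Fin n) :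
    i ∈ idx F S j ↔ S i ∈ F.E j := by
  simp [idx]

lemma setOf_idx_eq {n : ℕ} (F : Constraints 𝒳 𝒜 J K) (j : J) (I : Finset (Fin n)) :
    (fun S : Fin n → Point 𝒳 𝒜 => idx F S j) ⁻¹' {I}
      = {S | ∀ i, S i ∈ F.E j ↔ i ∈ Set.range (I.orderEmbOfFin rfl)} := by
  ext S
  simp only [Set.mem_preimage, Set.mem_singleton_iff, Set.mem_ofPred_eq, Finset.ext_iff, mem_idx,
    Finset.range_orderEmbOfFin, SetLike.mem_coe]

lemma measurableSet_idx_eq {n : ℕ} (F : Constraints 𝒳 𝒜 J K) (j : J) (I : Finset (Fin n)) :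
    MeasurableSet ((fun S : Fin n → Point 𝒳 𝒜 => idx F S j) ⁻¹' {I}) := by
  have h : (fun S : Fin n → Point 𝒳 𝒜 => idx F S j) ⁻¹' {I}
      = ⋂ i, {S | S i ∈ F.E j ↔ i ∈ I} := by
    ext S
    simp only [Set.mem_preimage, Set.mem_singleton_iff, Set.mem_iInter, Set.mem_ofPred_eq,
      Finset.ext_iff, mem_idx]
  rw [h]
  refine MeasurableSet.iInter fun i => ?_
  have hi : MeasurableSet {S : Fin n → Point 𝒳 𝒜 | S i ∈ F.E j} :=
    measurable_pi_apply i (F.measurableSet_E j)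
  by_cases hI : i ∈ I
  · simpa [hI] using hi
  · simp only [hI, iff_false]
    exact hi.compl

lemma measurable_count {n : ℕ} (F : Constraints 𝒳 𝒜 J K) (j : J) :
    Measurable fun S : Fin n → Point 𝒳 𝒜 => count F S j := by
  have : @Measurable _ _ _ ⊤ fun S : Fin n → Point 𝒳 𝒜 => idx F S j :=
    @measurable_to_countable' _ _ ⊤ _ _ _ fun I => measurableSet_idx_eq F j I
  exact (@measurable_from_top (Finset (Fin n)) ℕ _ Finset.card).comp this

/-- The empirical conditional moment is an average over the points in `E_j`. -/
lemma empMoment_eq_average {n : ℕ} (F : Constraints 𝒳 𝒜 J K) (S : Fin n → Point 𝒳 𝒜) (j : J)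
    (h : 𝒳 → Fin 2) {I : Finset (Fin n)} (hI : idx F S j = I) :
    empMoment F S j h = (I.card : ℝ)⁻¹ * ∑ k, momentLoss F j (S (I.orderEmbOfFin rfl k))
      (h (S (I.orderEmbOfFin rfl k)).1) := by
  subst hI
  rw [empMoment, count]
  congr 1
  conv_lhs => rw [← Finset.map_orderEmbOfFin_univ (idx F S j) rfl, Finset.sum_map]
  refine Finset.sum_congr rfl fun k _ => ?_
  rw [momentLoss, if_pos ((mem_idx F S j _).1 (Finset.orderEmbOfFin_mem _ rfl k))]
  rfl

/-- Uniform convergence of averages over a sample from the conditional distribution. -/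
lemma exists_uniform_cond_event [Nonempty H] (hH : ∀ h ∈ H, Measurable h)
    (hsup : SupMeasurable H D) (F : Constraints 𝒳 𝒜 J K) (j : J) {m : ℕ} (hm : 1 ≤ m)
    {C α δ : ℝ} (hα : α ≤ 1 / 2) (hδ : 0 < δ) (hδ1 : δ ≤ 4)
    (hR : rademacher H m ≤ C * (m : ℝ) ^ (-α)) :
    ∃ T : Set (Fin m → Point 𝒳 𝒜), MeasurableSet T ∧
      (D (F.E j) ≠ 0 → (Measure.pi fun _ : Fin m => ProbabilityTheory.cond D (F.E j)) T
        ≤ ENNReal.ofReal (δ / 4)) ∧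
      ∀ w ∉ T, ∀ h ∈ H, |(m : ℝ)⁻¹ * ∑ k, momentLoss F j (w k) (h (w k).1) - moment F D j h|
        ≤ (2 * C + 2 + √(Real.log (4 / δ) / 2)) * (m : ℝ) ^ (-α) := by
  by_cases h0 : D (F.E j) = 0
  -- For a null event everything is declared bad; the probability bound is only claimed when `D (F.E
  -- j) ≠ 0`.
  · exact ⟨Set.univ, MeasurableSet.univ, fun h => absurd h0 h, fun w hw => absurd trivial hw⟩
  have : IsProbabilityMeasure (ProbabilityTheory.cond D (F.E j)) := cond_isProbabilityMeasure h0
  have hmeas := measurable_iSup_momentLoss hsup F j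
  refine ⟨{w | (2 * C + 2 + √(Real.log (4 / δ) / 2)) * (m : ℝ) ^ (-α)
      ≤ deviation (ProbabilityTheory.cond D (F.E j))
        (fun (h : H) z => momentLoss F j z (h.1 z.1)) w},
    measurableSet_le measurable_const (measurable_deviation hmeas), fun _ => ?_,
    fun w hw h hh => ?_⟩
  · refine (ENNReal.le_ofReal_iff_toReal_le (measure_ne_top _ _) (by positivity)).2 ?_
    exact measure_deviation_classifier_le hH _ (measurable_momentLoss F j)
      (momentLoss_mem_unit F j) hmeas hm hα hδ hδ1 hR
  · refine le_trans ?_ (not_le.1 hw).le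
    have hdev := le_deviation (μ := ProbabilityTheory.cond D (F.E j))
      (φ := fun (h : H) z => momentLoss F j z (h.1 z.1))
      (fun h => measurable_comp_classifier (measurable_momentLoss F j) (hH _ h.2))
      (fun h z => momentLoss_mem_unit F j _ _) w ⟨h, hh⟩
    rw [integral_cond_momentLoss] at hdev
    exact hdev

/-- Uniform convergence of the empirical conditional moment, in terms of the random number of
points in the conditioning event. -/
theorem exists_uniform_moment_event [Nonempty H] (hH : ∀ h ∈ H, Measurable h)
    (hsup : SupMeasurable H D) (F : Constraints 𝒳 𝒜 J K) (j : J) (n : ℕ)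
    {C α δ : ℝ} (hα : α ≤ 1 / 2) (hδ : 0 < δ)
    (hδ1 : δ ≤ 4) (hR : ∀ m : ℕ, 1 ≤ m → rademacher H m ≤ C * (m : ℝ) ^ (-α)) :
    ∃ A : Set (Fin n → Point 𝒳 𝒜), MeasurableSet A ∧
      (Measure.pi fun _ : Fin n => D).real A ≤ δ / 4 ∧
      ∀ S ∉ A, 0 < count F S j → ∀ h ∈ H, |empMoment F S j h - moment F D j h|
        ≤ (2 * C + 2 + √(Real.log (4 / δ) / 2)) * (count F S j : ℝ) ^ (-α) := by
  choose T hT hTq hTdev using fun (m : ℕ) (hm : 1 ≤ m) =>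
    exists_uniform_cond_event hH hsup F j hm hα hδ hδ1 (hR m hm)
  -- `U I` is the failure when the points in `E_j` are exactly those indexed by `I`; empty `I` is
  -- excluded since no moment is then defined.
  let U : Finset (Fin n) → Set (Fin n → Point 𝒳 𝒜) := fun I =>
    ⋃ hI : 0 < I.card, (fun S => idx F S j) ⁻¹' {I} ∩
      {S | (fun k => S (I.orderEmbOfFin rfl k)) ∈ T I.card hI}
  have hU : ∀ I, MeasurableSet (U I) := fun I => MeasurableSet.iUnion fun hI =>
    (measurableSet_idx_eq F j I).inter
      ((measurable_pi_lambda _ fun k => measurable_pi_apply _) (hT _ hI))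
  have hUle : ∀ I, (Measure.pi fun _ : Fin n => D) (U I) ≤ ENNReal.ofReal (δ / 4) *
      (Measure.pi fun _ : Fin n => D) ((fun S => idx F S j) ⁻¹' {I}) := fun I => by
    by_cases hI : 0 < I.card
    · simp only [U, hI, Set.iUnion_true]
      rw [setOf_idx_eq]
      exact measure_forall_mem_iff_inter_le D (F.measurableSet_E j) hI
        (I.orderEmbOfFin rfl).injective (hT _ hI) (hTq _ hI)
    · simp only [U, hI, Set.iUnion_of_empty, measure_empty]
      exact bot_le
  refine ⟨⋃ I, U I, MeasurableSet.iUnion hU, ?_, fun S hS hc h hh => ?_⟩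
  · refine ENNReal.toReal_le_of_le_ofReal (by positivity) ?_
    refine (measure_iUnion_le U).trans ?_
    rw [tsum_fintype]
    refine (Finset.sum_le_sum fun I _ => hUle I).trans ?_
    -- The pieces are disjoint with total mass at most 1, so no union bound over the values of `n_j`
    -- is paid.
    rw [← Finset.mul_sum, sum_measure_preimage_singleton _ fun I _ => measurableSet_idx_eq F j I]
    exact mul_le_of_le_one_right bot_le prob_le_one
  · have hST : (fun k => S ((idx F S j).orderEmbOfFin rfl k)) ∉ T (idx F S j).card hc :=
      fun hmem => hS (Set.mem_iUnion.2 ⟨idx F S j, Set.mem_iUnion.2 ⟨hc, rfl, hmem⟩⟩)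
    rw [empMoment_eq_average F S j h rfl]
    exact hTdev _ hc _ hST h hh

/-- The number of points in `E_j` is at least half its expectation, if the latter is large. -/
theorem exists_count_event (F : Constraints 𝒳 𝒜 J K) (j : J) (n : ℕ) {δ : ℝ} (hδ : 0 < δ) :
    ∃ A : Set (Fin n → Point 𝒳 𝒜), MeasurableSet A ∧
      (Measure.pi fun _ : Fin n => D).real A ≤ δ / 2 ∧
      ∀ S ∉ A, 8 * Real.log (2 / δ) ≤ n * D.real (F.E j) →
        n * D.real (F.E j) / 2 < count F S j := by
  by_cases hp : 8 * Real.log (2 / δ) ≤ n * D.real (F.E j)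
  · refine ⟨{S | (count F S j : ℝ) ≤ n * D.real (F.E j) / 2}, ?_, ?_, fun S hS _ => not_le.1 hS⟩
    · exact measurableSet_le (measurable_from_top.comp (measurable_count F j)) measurable_const
    · refine (card_filter_le_half D (F.measurableSet_E j) n).trans ?_
      have h2 : δ / 2 = Real.exp (-Real.log (2 / δ)) := by
        rw [Real.exp_neg, Real.exp_log (by positivity), inv_div]
      rw [h2]
      exact Real.exp_le_exp.2 (by linarith)
  · exact ⟨∅, MeasurableSet.empty, by simp; positivity, fun S _ h => absurd h hp⟩

end UniformConvergence

/-- A sample that is twice as large as required loses at most a factor two in the rate. -/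
lemma rpow_neg_le_two_mul {x m α : ℝ} (hx : 0 < x) (hm : x / 2 < m) (h0 : 0 ≤ α) (h1 : α ≤ 1) :
    m ^ (-α) ≤ 2 * x ^ (-α) := by
  have h2 : (2 : ℝ) ^ α ≤ 2 := by
    simpa using Real.rpow_le_rpow_of_exponent_le one_le_two h1
  calc m ^ (-α) ≤ (x / 2) ^ (-α) :=
        Real.rpow_le_rpow_of_nonpos (by positivity) hm.le (by linarith)
    _ = 2 ^ α * x ^ (-α) := by
        rw [Real.div_rpow hx.le zero_le_two, Real.rpow_neg zero_le_two, div_inv_eq_mul, mul_comm]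
    _ ≤ 2 * x ^ (-α) := by gcongr

/-! ### The good event for the sample. -/

section Sample

variable {𝒳 𝒜 J K : Type*} [MeasurableSpace 𝒳] [MeasurableSpace 𝒜] [Fintype J]
  {H : Set (𝒳 → Fin 2)} {D : Measure (Point 𝒳 𝒜)} [IsProbabilityMeasure D]

/-- The good event for the sample: all empirical quantities are uniformly close to their
expectations, and the counts are not much smaller than expected. -/
theorem exists_good_sample_event [Nonempty H] (hH : ∀ h ∈ H, Measurable h)
    (hsup : SupMeasurable H D) (F : Constraints 𝒳 𝒜 J K) {n : ℕ} (hn : 1 ≤ n)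
    {C α δ : ℝ} (hα : α ≤ 1 / 2) (hδ : 0 < δ) (hδ1 : δ ≤ 4)
    (hR : ∀ m : ℕ, 1 ≤ m → rademacher H m ≤ C * (m : ℝ) ^ (-α)) :
    ∃ A : Set (Fin n → Point 𝒳 𝒜), MeasurableSet A ∧
      1 - (Fintype.card J + 1) * δ ≤ (Measure.pi fun _ : Fin n => D).real A ∧
      ∀ S ∈ A,
        (∀ h ∈ H, |empErr S h - err D h|
          ≤ (2 * C + 2 + √(Real.log (4 / δ) / 2)) * (n : ℝ) ^ (-α)) ∧
        (∀ j, 0 < count F S j → ∀ h ∈ H, |empMoment F S j h - moment F D j h|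
          ≤ (2 * C + 2 + √(Real.log (4 / δ) / 2)) * (count F S j : ℝ) ^ (-α)) ∧
        ∀ j, 8 * Real.log (2 / δ) ≤ n * D.real (F.E j) →
          n * D.real (F.E j) / 2 < count F S j := by
  obtain ⟨A₀, hA₀, hA₀P, hA₀S⟩ :=
    exists_uniform_err_event hH hsup hn hα hδ hδ1 (hR n hn)
  choose A₁ hA₁ hA₁P hA₁S using fun j =>
    exists_uniform_moment_event hH hsup F j n hα hδ hδ1 hR
  choose A₂ hA₂ hA₂P hA₂S using fun j => exists_count_event (D := D) F j n hδ
  set ρ : Measure (Fin n → Point 𝒳 𝒜) := Measure.pi fun _ => D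
  have hbad : MeasurableSet (A₀ ∪ ⋃ j, (A₁ j ∪ A₂ j)) :=
    hA₀.union (MeasurableSet.iUnion fun j => (hA₁ j).union (hA₂ j))
  refine ⟨(A₀ ∪ ⋃ j, (A₁ j ∪ A₂ j))ᶜ, hbad.compl, ?_, fun S hS => ?_⟩
  · rw [probReal_compl_eq_one_sub hbad]
    -- Each `j` costs `δ/4 + δ/2 ≤ δ`, and the error event costs a further `δ/4`.
    have h1 : ρ.real (⋃ j, (A₁ j ∪ A₂ j)) ≤ Fintype.card J * δ := by
      refine (measureReal_iUnion_fintype_le _).trans ?_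
      refine (Finset.sum_le_sum (g := fun _ => δ) fun j _ => ?_).trans (by simp)
      refine (measureReal_union_le _ _).trans ?_
      linarith [hA₁P j, hA₂P j]
    have h2 := measureReal_union_le (μ := ρ) A₀ (⋃ j, (A₁ j ∪ A₂ j))
    linarith
  · simp only [Set.mem_compl_iff, Set.mem_union, Set.mem_iUnion, not_or, not_exists] at hS
    exact ⟨hA₀S S hS.1, fun j => hA₁S j S (hS.2 j).1, fun j => hA₂S j S (hS.2 j).2⟩

end Sample

end FairClass

end

/-! ### The main theorem. -/

theorem theorem2
    {𝒳 𝒜 J K Ω : Type*} [MeasurableSpace 𝒳] [MeasurableSpace 𝒜] [Fintype J] [Fintype K]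
    [MeasurableSpace Ω]
    -- the classifiers, the distribution of `(X, A, Y)`, and the fairness constraints
    (H : Set (𝒳 → Fin 2)) (hH : ∀ h ∈ H, Measurable h)
    (D : Measure (FairClass.Point 𝒳 𝒜)) [IsProbabilityMeasure D]
    (hsup : FairClass.SupMeasurable H D)
    (F : FairClass.Constraints 𝒳 𝒜 J K)
    -- the training sample of size `n`
    (P : Measure Ω) [IsProbabilityMeasure P]
    (n : ℕ) (hn : 1 ≤ n) (Z : Fin n → Ω → FairClass.Point 𝒳 𝒜)
    (hZ : ∀ i, Measurable (Z i)) (hind : iIndepFun Z P) (hlaw : ∀ i, P.map (Z i) = D)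
    -- the Rademacher assumption and the parameters
    (C C' α δ : ℝ) (hC : 0 ≤ C) (hα : α ≤ 1 / 2) (hδ : 0 < δ)
    (hR : ∀ m : ℕ, 1 ≤ m → FairClass.rademacher H m ≤ C * (m : ℝ) ^ (-α))
    (hC' : 2 * C + 2 + √(Real.log (4 / δ) / 2) ≤ C')
    (B ν : ℝ) (hB : 0 < B)
    (Qstar : PMF H) (hQstar : FairClass.IsOptimal F D Qstar) :
    ∃ G : Set Ω, MeasurableSet G ∧ 1 - (Fintype.card J + 1) * δ ≤ P.real G ∧
      ∀ ω ∈ G,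
        -- bounds in terms of the counts `n_j`
        ((∀ j, 0 < FairClass.count F (fun i => Z i ω) j) →
          ∀ (Q : PMF H) (l : K → ℝ),
            FairClass.IsApproxSaddle F (fun i => Z i ω)
                (fun k => F.c k + FairClass.slack F (fun i => Z i ω) C' α k) B ν Q l →
              FairClass.errQ D Q ≤ FairClass.errQ D Qstar + 2 * ν
                  + (4 * C + 4 + √(2 * Real.log (4 / δ))) * (n : ℝ) ^ (-α) ∧
              ∀ k, FairClass.gammaQ F D Q k ≤ F.c k + (1 + 2 * ν) / B
                  + ∑ j, |F.M k j| *
                      (2 * C' * (FairClass.count F (fun i => Z i ω) j : ℝ) ^ (-α))) ∧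
        -- bounds in terms of the expected counts `n p_j`
        ((∀ j, 8 * Real.log (2 / δ) ≤ n * D.real (F.E j)) →
          (∀ j, 0 < FairClass.count F (fun i => Z i ω) j) ∧
          ∀ (Q : PMF H) (l : K → ℝ),
            FairClass.IsApproxSaddle F (fun i => Z i ω)
                (fun k => F.c k + FairClass.slack F (fun i => Z i ω) C' α k) B ν Q l →
              ∀ k, FairClass.gammaQ F D Q k ≤ F.c k + (1 + 2 * ν) / B
                  + ∑ j, |F.M k j| * (4 * C' * (n * D.real (F.E j)) ^ (-α))) := by
  classical
  by_cases hδ1 : 1 ≤ δ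
  · refine ⟨∅, MeasurableSet.empty, ?_, fun ω hω => absurd hω (Set.notMem_empty ω)⟩
    have : (0 : ℝ) ≤ Fintype.card J * δ := by positivity
    simp only [measureReal_empty]
    linarith
  push Not at hδ1
  -- A probability mass function has nonempty support.
  have hHne : Nonempty H := ⟨Qstar.support_nonempty.some⟩
  obtain ⟨A, hA, hAP, hAS⟩ :=
    FairClass.exists_good_sample_event hH hsup F hn hα hδ (by linarith) hR
  have hZm : Measurable fun ω i => Z i ω := measurable_pi_lambda _ hZ
  have hmap : P.map (fun ω i => Z i ω) = Measure.pi fun _ => D := by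
    rw [(iIndepFun_iff_map_fun_eq_pi_map fun i => (hZ i).aemeasurable).1 hind]
    simp_rw [hlaw]
  refine ⟨(fun ω i => Z i ω) ⁻¹' A, hZm hA, ?_, fun ω hω => ?_⟩
  · rw [← hmap, map_measureReal_apply hZm hA] at hAP
    exact hAP
  obtain ⟨herr, hmom, hcount⟩ := hAS _ hω
  refine ⟨fun hpos Q l hs => ⟨?_, ?_⟩, fun hlarge => ?_⟩
  · have h := FairClass.errQ_le_of_isApproxSaddle hH hQstar hB hC' herr
      (fun j => hmom j (hpos j)) hs
    have hsqrt : √(2 * Real.log (4 / δ)) = 2 * √(Real.log (4 / δ) / 2) := by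
      rw [show 2 * Real.log (4 / δ) = 2 ^ 2 * (Real.log (4 / δ) / 2) by ring,
        Real.sqrt_mul (by norm_num), Real.sqrt_sq zero_le_two]
    rw [hsqrt]
    linarith
  · exact FairClass.gammaQ_le_of_isApproxSaddle hH hQstar hB hC' (fun j => hmom j (hpos j)) hs
  · have hlog : Real.log 2 ≤ Real.log (2 / δ) :=
      Real.log_le_log zero_lt_two ((le_div_iff₀ hδ).2 (by linarith))
    -- As `δ < 1`, the assumption gives `n p_j ≥ 8 log 2 > 1`.
    have hnp : ∀ j, 1 ≤ n * D.real (F.E j) := fun j => by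
      linarith [hlarge j, Real.log_two_gt_d9]
    have hpos : ∀ j, 0 < FairClass.count F (fun i => Z i ω) j := fun j => by
      have : (0 : ℝ) < FairClass.count F (fun i => Z i ω) j := by
        linarith [hcount j (hlarge j), hnp j]
      exact_mod_cast this
    have hC'2 : 2 ≤ C' := by linarith [Real.sqrt_nonneg (Real.log (4 / δ) / 2)]
    refine ⟨hpos, fun Q l hs k => ?_⟩
    -- For `α ≥ 0` a lower bound on the counts controls `n_j ^ (-α)`. For `α < 0` it does not, but
    -- then `4 C' (n p_j) ^ (-α) ≥ 1`, and moments of two mixtures never differ by more than 1.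
    rcases le_or_gt 0 α with h0 | h0
    · refine (FairClass.gammaQ_le_of_isApproxSaddle hH hQstar hB hC'
        (fun j => hmom j (hpos j)) hs k).trans ?_
      gcongr F.c k + (1 + 2 * ν) / B + ∑ j, |F.M k j| * ?_ with j
      have h := FairClass.rpow_neg_le_two_mul (lt_of_lt_of_le one_pos (hnp j))
        (hcount j (hlarge j)) h0 (by linarith)
      nlinarith
    · refine (FairClass.gammaQ_le_of_feasible hH hQstar Q k
        (b := fun j => 4 * C' * (n * D.real (F.E j)) ^ (-α)) fun j => ?_).trans ?_
      · have := Real.one_le_rpow (hnp j) (by linarith : 0 ≤ -α)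
        nlinarith
      · have : 0 ≤ (1 + 2 * ν) / B := div_nonneg (by linarith [hs.nonneg]) hB.le
        linarith
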